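/- Let $n\ge 1$ and let $A,F,Q\in\mathbb R^{n\times n}$. Write $\mathbb C^-=\{z\in\mathbb C:\operatorname{Re}z<0\}$ and let $\mathcal W(M)=\{x^HMx:\ x\in\mathbb C^m,\ \|x\|_2=1\}$ denote the numerical range of an $m\times m$ matrix $M$. For $M\in\mathbb R^{n\times n}$ let $$\mathrm{Off}(M)=\{M(s+1:n,\,1:s):\ 1\le s\le n-1\}\cup\{M(1:s,\,s+1:n):\ 1\le s\le n-1\},$$ and call $M$ quasiseparable of order $r$ if $r$ is the maximal rank of the matrices in $\mathrm{Off}(M)$ ($r=0$ if $n=1$). Assume that $\mathcal W(A)\subset\mathbb C^-$, that $F$ and $Q$ are symmetric positive semidefinite, and that $A,F,Q$ are quasiseparable of orders $r_a,r_f,r_q$, respectively. Let $X\in\mathbb R^{n\times n}$ be the stabilizing solution of $$A^\top X+XA-XFX+Q=0,$$ that is, its symmetric positive semidefinite solution, for which the closed-loop matrix $A-FX$ has eigenvalues with non-positive real parts. For $j=1,\dots,n$ let $A^{(j)},F^{(j)},Q^{(j)}$ (resp. $A_{(j)},F_{(j)},Q_{(j)}$) be the principal submatrices of $A,F,Q$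 on the first (resp. last) $j$ indices, and let $X^{(j)}$ (resp. $X_{(j)}$) be the symmetric positive semidefinite stabilizing solution of the Riccati equation with these coefficients. Let $E\subset\mathbb C^-$ be a set with $$\mathrm{conv}\Big(\bigcup_{j=1}^n\mathcal W\big(A^{(j)}-F^{(j)}X^{(j)}\big)\ \cup\ \bigcup_{j=1}^n\mathcal W\big(A_{(j)}-F_{(j)}X_{(j)}\big)\Big)\subset E .$$ Then, if $X\neq 0$, the singular values $\sigma_1(M)\ge\sigma_2(M)\ge\dots$ (with $\sigma_i(M)=0$ when $i$ exceeds the number of rows or columns of $M$) of every $M\in\mathrm{Off}(X)$ satisfy $$\frac{\sigma_{ht+1}(M)}{\|X\|_2}\le(1+\sqrt2)^2\,Z_h(E,-E),\qquad h=1,2,\dots,\qquad t=4r_a+2r_f+2r_q,$$ where $$Z_h(E,-E)=\inf_{g}\frac{\sup_{z\in E}|g(z)|}{\inf_{z\in -E}|g(z)|}$$ is the $h$-th Zolotarev number: $g$ ranges over the rational functions with numerator and denominator of degree at most $h$, $|g|=\infty$ at poles, with $\sup_E|g|<\infty$ and $\inf_{-E}|g|>0$. -/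

import Mathlib

open scoped Pointwise ENNReal Matrix

noncomputable section

namespace Care

/-- The open left half-plane `ℂ⁻`. -/
def leftHalfPlane : Set ℂ := {z | z.re < 0}

/-- The numerical range `{xᴴ M x : x ∈ ℂⁿ, ‖x‖₂ = 1}` of a complex square matrix. -/
def numericalRange {ι : Type*} [Fintype ι] (M : Matrix ι ι ℂ) : Set ℂ :=
  {z | ∃ x : EuclideanSpace ℂ ι, ‖x‖ = 1 ∧ z = star x.ofLp ⬝ᵥ (M *ᵥ x.ofLp)}

/-- A real matrix viewed as a complex one. -/
def toComplex {ι κ : Type*} (M : Matrix ι κ ℝ) : Matrix ι κ ℂ :=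
  M.map (fun a : ℝ => (a : ℂ))

/-- The spectral norm of a real square matrix: the operator norm for the Euclidean norm. -/
def spectralNorm {ι : Type*} [Fintype ι] [DecidableEq ι] (M : Matrix ι ι ℝ) : ℝ :=
  ‖Matrix.toEuclideanCLM (n := ι) (𝕜 := ℝ) M‖

/-- The `k`-th singular value of a real matrix, numbered from `k = 1` in decreasing order
(it is zero once `k` exceeds the number of rows or of columns). Mathlib's numbering starts
from `0`. -/
def singularValue {ι κ : Type*} [Fintype ι] [Fintype κ] [DecidableEq κ]
    (M : Matrix ι κ ℝ) (k : ℕ) : ℝ :=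
  (Matrix.toEuclideanLin M).singularValues (k - 1)

/-- The lower off-diagonal block `M(s+1:n, 1:s)`. -/
def lowerBlock {n : ℕ} (M : Matrix (Fin n) (Fin n) ℝ) (s : ℕ) :
    Matrix {i : Fin n // s ≤ (i : ℕ)} {i : Fin n // (i : ℕ) < s} ℝ :=
  M.submatrix Subtype.val Subtype.val

/-- The upper off-diagonal block `M(1:s, s+1:n)`. -/
def upperBlock {n : ℕ} (M : Matrix (Fin n) (Fin n) ℝ) (s : ℕ) :
    Matrix {i : Fin n // (i : ℕ) < s} {i : Fin n // s ≤ (i : ℕ)} ℝ :=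
  M.submatrix Subtype.val Subtype.val

/-- The quasiseparable order: the maximal rank of the off-diagonal blocks, `s = 1, …, n - 1`. -/
def qsrank {n : ℕ} (M : Matrix (Fin n) (Fin n) ℝ) : ℕ :=
  (Finset.Ico 1 n).sup fun s => max (lowerBlock M s).rank (upperBlock M s).rank

/-- The indices of the first `j` rows and columns. -/
abbrev FirstIdx (n j : ℕ) : Type := {i : Fin n // (i : ℕ) < j}

/-- The indices of the last `j` rows and columns. -/
abbrev LastIdx (n j : ℕ) : Type := {i : Fin n // n ≤ (i : ℕ) + j}

/-- The leading principal submatrix on the first `j` indices. -/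
def leading {n : ℕ} (M : Matrix (Fin n) (Fin n) ℝ) (j : ℕ) :
    Matrix (FirstIdx n j) (FirstIdx n j) ℝ :=
  M.submatrix Subtype.val Subtype.val

/-- The trailing principal submatrix on the last `j` indices. -/
def trailing {n : ℕ} (M : Matrix (Fin n) (Fin n) ℝ) (j : ℕ) :
    Matrix (LastIdx n j) (LastIdx n j) ℝ :=
  M.submatrix Subtype.val Subtype.val

/-- The closed-loop matrix `A - F X`. -/
def closedLoop {ι : Type*} [Fintype ι] (A F X : Matrix ι ι ℝ) : Matrix ι ι ℝ :=
  A - F * X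

/-- `X` is the symmetric positive semidefinite stabilizing solution of
`Aᵀ X + X A - X F X + Q = 0`, the Riccati equation associated with the Hamiltonian matrix
`[A, -F; -Q, -Aᵀ]`: the eigenvalues of the closed-loop matrix have non-positive real parts. -/
structure IsStabilizingSolution {ι : Type*} [Fintype ι] [DecidableEq ι]
    (A F Q X : Matrix ι ι ℝ) : Prop where
  posSemidef : X.PosSemidef
  riccati : Aᵀ * X + X * A - X * F * X + Q = 0
  stable : ∀ μ ∈ spectrum ℂ (toComplex (closedLoop A F X)), μ.re ≤ 0

/-- The modulus `|g(z)|` of a rational function, equal to `∞` at the poles. The numerator and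
the denominator of a `RatFunc` are coprime. -/
def ratAbs (g : RatFunc ℂ) (z : ℂ) : ℝ≥0∞ :=
  if g.denom.eval z = 0 then ⊤ else ENNReal.ofReal ‖g.num.eval z / g.denom.eval z‖

/-- The rational functions admitted at level `h` for the pair `(E, G)`: numerator and denominator
have degree at most `h`, and the quotient `sup_E |g| / inf_G |g|` is not of the form `∞ / _` or
`_ / 0`. -/
def zolotarevAdmissible (h : ℕ) (E G : Set ℂ) : Set (RatFunc ℂ) :=
  {g | g.num.natDegree ≤ h ∧ g.denom.natDegree ≤ h ∧
    (⨆ z ∈ E, ratAbs g z) ≠ ⊤ ∧ (⨅ z ∈ G, ratAbs g z) ≠ 0}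

/-- The `h`-th Zolotarev number of `(E, G)`, the infimum of `sup_E |g| / inf_G |g|` over rational
functions of type `(h, h)`. The infimum is at most `1` (take `g = 1`), hence finite. -/
def zolotarev (h : ℕ) (E G : Set ℂ) : ℝ :=
  (⨅ g ∈ zolotarevAdmissible h E G,
    (⨆ z ∈ E, ratAbs g z) / (⨅ z ∈ G, ratAbs g z)).toReal

end Care

end

/-!
The off-diagonal block of `X` on the index sets `f`, `g` solves a Sylvester equation
`C_ffᵀ Y + Y C_gg = L`, where `C = A - F X` is the closed-loop matrix: all the terms of the Riccati
equation that involve diagonal blocks of `A` and `F` are absorbed into the coefficients, and those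
left in `L` contain an off-diagonal block of `A`, `F` or `Q`, so that `L` has small rank `t`.

For polynomials `p`, `q` of degree at most `h` and `B Y - Y D = L`, the matrix `p(B) Y q(D) -
q(B) Y p(D)` has its range in a block Krylov space, hence rank at most `h t`. Multiplying by
`q(B)⁻¹` and `p(D)⁻¹`, the matrix `Y` is within `‖(p/q)(B)‖ ‖(q/p)(D)‖ ‖Y‖` of a matrix of rank at
most `h t`. The theorem of Crouzeix and Palencia bounds each of the two rational functions by
`1 + √2` times its supremum over the numerical range, and those of the compressions `C_ff`, `C_gg`
lie in that of `C`.

For the Crouzeix–Palencia theorem, let the operator `T` have its numerical range inside a smooth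
convex curve and let `f` be bounded by `1`. The operator-valued double-layer potential is positive
with total mass `2`, so that `f(T) + (Cf̄)(T)*` has norm at most `2`, where `Cf̄` is the Cauchy
integral of the conjugate of `f`; since `Cf̄` is itself bounded by `1`, the best constant `K`
satisfies `K ^ 4 ≤ 2 * K ^ 3 + K ^ 2`, that is `K ≤ 1 + √2`. Every matrix is a limit of matrices
with simple spectrum, and every convex compact set is a limit of domains bounded by smooth convex
curves.
-/

noncomputable section

open Complex MeasureTheory Filter Topology intervalIntegral
open scoped Real ComplexConjugate

namespace Care

/-! ### Convex curves parametrised by the direction of the outer normal -/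

lemma exp_neg_mul_I_mul_exp (θ : ℝ) : cexp (-(θ * I)) * cexp (θ * I) = 1 := by
  rw [← Complex.exp_add, neg_add_cancel, Complex.exp_zero]

lemma norm_exp_neg_mul_I (θ : ℝ) : ‖cexp (-(θ * I))‖ = 1 := by
  rw [← neg_mul, ← ofReal_neg, norm_exp_ofReal_mul_I]

lemma periodic_exp_neg_mul_I :
    Function.Periodic (fun θ : ℝ => cexp (-(θ * I))) (2 * π) := fun θ => by
  have h : -(((θ + 2 * π : ℝ) : ℂ) * I) = -(θ * I) - 2 * π * I := by push_cast; ring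
  simpa only [h] using Complex.exp_periodic.sub_eq _

/-- A closed curve whose tangent at the parameter `θ` is a positive multiple of `i e^{iθ}`. Such a
curve bounds a smooth strictly convex domain, with outer normal `e^{iθ}` at the parameter `θ`. -/
structure ConvexCurve where
  pt : ℝ → ℂ
  /-- This is also the radius of curvature, as the tangent turns at unit rate. -/
  speed : ℝ → ℝ
  speed_pos : ∀ θ, 0 < speed θ
  continuous_speed : Continuous speed
  periodic_speed : Function.Periodic speed (2 * π)
  periodic_pt : Function.Periodic pt (2 * π)
  hasDerivAt_pt : ∀ θ : ℝ, HasDerivAt pt (I * cexp (θ * I) * speed θ) θ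

namespace ConvexCurve

variable (γ : ConvexCurve) {z : ℂ}

/-- The vector from `z` to the point of the curve with parameter `θ`, in the frame in which the
outer normal at this point is `1`. Its real part is the signed distance of `z` to the supporting
line at this point. -/
def offset (z : ℂ) (θ : ℝ) : ℂ := cexp (-(θ * I)) * (γ.pt θ - z)

/-- The open domain enclosed by the curve, as an intersection of half-planes. -/
def region : Set ℂ := {z | ∀ θ, 0 < (γ.offset z θ).re}

/-- The signed distance of `z` to the nearest supporting line of the curve. -/
def depth (z : ℂ) : ℝ := ⨅ θ, (γ.offset z θ).re

@[fun_prop]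
lemma continuous_pt : Continuous γ.pt :=
  continuous_iff_continuousAt.2 fun θ => (γ.hasDerivAt_pt θ).continuousAt

lemma pt_sub_eq (z : ℂ) (θ : ℝ) : γ.pt θ - z = cexp (θ * I) * γ.offset z θ := by
  rw [offset]
  linear_combination -(γ.pt θ - z) * exp_neg_mul_I_mul_exp θ

lemma offset_sub_offset (z z' : ℂ) (θ : ℝ) :
    γ.offset z θ - γ.offset z' θ = cexp (-(θ * I)) * (z' - z) := by
  simp only [offset]
  ring

lemma periodic_offset (z : ℂ) : Function.Periodic (γ.offset z) (2 * π) := fun θ => by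
  have h : cexp (-((θ + 2 * π : ℝ) * I)) = cexp (-(θ * I)) := periodic_exp_neg_mul_I θ
  simp only [offset, γ.periodic_pt θ, h]

@[fun_prop]
lemma continuous_offset (z : ℂ) : Continuous (γ.offset z) := by
  unfold offset
  fun_prop

lemma hasDerivAt_offset (z : ℂ) (θ : ℝ) :
    HasDerivAt (γ.offset z) (-I * γ.offset z θ + I * γ.speed θ) θ := by
  have hexp : HasDerivAt (fun θ : ℝ => cexp (-(θ * I))) (cexp (-(θ * I)) * (-(1 * I))) θ :=
    ((ofRealCLM.hasDerivAt (x := θ)).mul_const I).neg.cexp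
  refine (hexp.mul ((γ.hasDerivAt_pt θ).sub_const z)).congr_deriv ?_
  simp only [offset]
  linear_combination I * γ.speed θ * exp_neg_mul_I_mul_exp θ

lemma isCompact_range_pt : IsCompact (Set.range γ.pt) :=
  γ.periodic_pt.compact_of_continuous Real.two_pi_pos.ne' γ.continuous_pt

lemma exists_speed_le : ∃ R, ∀ θ, γ.speed θ ≤ R := by
  obtain ⟨R, hR⟩ := (γ.periodic_speed.compact_of_continuous Real.two_pi_pos.ne'
    γ.continuous_speed).bddAbove
  exact ⟨R, fun θ => hR ⟨θ, rfl⟩⟩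

lemma bddBelow_re_offset (z : ℂ) : BddBelow (Set.range fun θ => (γ.offset z θ).re) :=
  (Function.Periodic.compact_of_continuous (fun θ => by rw [γ.periodic_offset z θ])
    Real.two_pi_pos.ne' (by fun_prop)).bddBelow

lemma depth_le (z : ℂ) (θ : ℝ) : γ.depth z ≤ (γ.offset z θ).re :=
  ciInf_le (γ.bddBelow_re_offset z) θ

lemma depth_le_norm_offset (z : ℂ) (θ : ℝ) : γ.depth z ≤ ‖γ.offset z θ‖ :=
  (γ.depth_le z θ).trans (re_le_norm _)

lemma exists_re_offset_eq_depth (z : ℂ) : ∃ θ, (γ.offset z θ).re = γ.depth z :=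
  (Function.Periodic.compact_of_continuous (fun θ => by rw [γ.periodic_offset z θ])
    Real.two_pi_pos.ne' (by fun_prop)).sInf_mem (Set.range_nonempty _)

lemma mem_region_iff : z ∈ γ.region ↔ 0 < γ.depth z := by
  obtain ⟨θ, hθ⟩ := γ.exists_re_offset_eq_depth z
  exact ⟨fun h => hθ ▸ h θ, fun h θ => h.trans_le (γ.depth_le z θ)⟩

lemma depth_le_depth_add_dist (z z' : ℂ) : γ.depth z ≤ γ.depth z' + dist z z' := by
  obtain ⟨θ, hθ⟩ := γ.exists_re_offset_eq_depth z'
  have h := re_le_norm (γ.offset z θ - γ.offset z' θ)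
  rw [sub_re, offset_sub_offset, norm_mul, norm_exp_neg_mul_I, one_mul, ← dist_eq_norm,
    dist_comm] at h
  linarith [γ.depth_le z θ]

lemma continuous_depth : Continuous γ.depth :=
  (LipschitzWith.of_le_add fun z z' => γ.depth_le_depth_add_dist z z').continuous

lemma isOpen_region : IsOpen γ.region := by
  have h : γ.region = {z | 0 < γ.depth z} := Set.ext fun _ => γ.mem_region_iff
  exact h ▸ isOpen_lt continuous_const γ.continuous_depth

lemma convex_region : Convex ℝ γ.region := by
  have h : γ.region = ⋂ θ : ℝ, {z | (cexp (-(θ * I)) * z).re < (cexp (-(θ * I)) * γ.pt θ).re} := by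
    ext z
    simp only [region, offset, mul_sub, sub_re, sub_pos, Set.mem_iInter, Set.mem_ofPred_eq]
  rw [h]
  exact convex_iInter fun θ => convex_halfSpace_lt
    (f := fun z => (cexp (-(θ * I)) * z).re)
    ⟨fun z w => by rw [mul_add, add_re], fun c z => by rw [mul_smul_comm, smul_re]⟩ _

/-- The imaginary part of the offset is the derivative of its real part, hence vanishes at a
minimum. -/
lemma exists_pt_sub_eq_depth_mul (z : ℂ) :
    ∃ θ : ℝ, γ.pt θ - z = cexp (θ * I) * γ.depth z := by
  obtain ⟨θ, hθ⟩ := γ.exists_re_offset_eq_depth z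
  have hderiv : HasDerivAt (fun θ => (γ.offset z θ).re) (γ.offset z θ).im θ :=
    (reCLM.hasFDerivAt.comp_hasDerivAt θ (γ.hasDerivAt_offset z θ)).congr_deriv (by simp)
  have hmin : IsLocalMin (fun θ => (γ.offset z θ).re) θ :=
    Eventually.of_forall fun φ => hθ.trans_le (γ.depth_le z φ)
  have hoffset : γ.offset z θ = γ.depth z :=
    Complex.ext (by simp [hθ]) (by simp [hmin.hasDerivAt_eq_zero hderiv])
  exact ⟨θ, by rw [pt_sub_eq, hoffset]⟩

lemma isBounded_region : Bornology.IsBounded γ.region := by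
  obtain ⟨R, hR⟩ := γ.isCompact_range_pt.isBounded.exists_norm_le
  refine (Metric.isBounded_closedBall (x := (0 : ℂ)) (r := R)).subset fun z hz => ?_
  have hz_polar : cexp (-(z.arg * I)) * z = ‖z‖ := by
    linear_combination -cexp (-(z.arg * I)) * norm_mul_exp_arg_mul_I z +
      ‖z‖ * exp_neg_mul_I_mul_exp z.arg
  have hpos := hz z.arg
  rw [offset, mul_sub, hz_polar, sub_re, ofReal_re] at hpos
  have hle := re_le_norm (cexp (-(z.arg * I)) * γ.pt z.arg)
  rw [norm_mul, norm_exp_neg_mul_I, one_mul] at hle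
  rw [mem_closedBall_zero_iff]
  linarith [hR _ ⟨z.arg, rfl⟩]

lemma hasDerivAt_re_offset_pt (θ φ : ℝ) : HasDerivAt (fun φ => (γ.offset (γ.pt φ) θ).re)
    (Real.sin (φ - θ) * γ.speed φ) φ := by
  have h : HasDerivAt (fun φ => γ.offset (γ.pt φ) θ)
      (cexp (-(θ * I)) * -(I * cexp (φ * I) * γ.speed φ)) φ :=
    ((γ.hasDerivAt_pt φ).const_sub _).const_mul _
  have hexp : cexp (-(θ * I)) * cexp (φ * I) = cexp ((φ - θ : ℝ) * I) := by
    rw [← Complex.exp_add]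
    congr 1
    push_cast
    ring
  refine (reCLM.hasFDerivAt.comp_hasDerivAt φ h).congr_deriv ?_
  rw [show cexp (-(θ * I)) * -(I * cexp (φ * I) * γ.speed φ) =
    -(I * cexp ((φ - θ : ℝ) * I)) * γ.speed φ by rw [← hexp]; ring]
  simp only [reCLM_apply, re_mul_ofReal, neg_re, I_mul_re, exp_ofReal_mul_I_im, neg_neg]

lemma re_offset_pt_pos {θ φ : ℝ} (hφ : φ ∈ Set.Ioo θ (θ + 2 * π)) :
    0 < (γ.offset (γ.pt φ) θ).re := by
  have hcont : Continuous fun φ => (γ.offset (γ.pt φ) θ).re :=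
    continuous_iff_continuousAt.2 fun φ => (γ.hasDerivAt_re_offset_pt θ φ).continuousAt
  rcases le_total φ (θ + π) with h | h
  · have hmono : StrictMonoOn (fun φ => (γ.offset (γ.pt φ) θ).re) (Set.Icc θ (θ + π)) :=
      strictMonoOn_of_hasDerivWithinAt_pos (convex_Icc _ _) hcont.continuousOn
        (fun x _ => (γ.hasDerivAt_re_offset_pt θ x).hasDerivWithinAt) fun x hx => by
          rw [interior_Icc] at hx
          exact mul_pos (Real.sin_pos_of_pos_of_lt_pi (by linarith [hx.1]) (by linarith [hx.2]))
            (γ.speed_pos x)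
    simpa [offset] using hmono ⟨le_rfl, by linarith [Real.pi_pos]⟩ ⟨hφ.1.le, h⟩ hφ.1
  · have hanti : StrictAntiOn (fun φ => (γ.offset (γ.pt φ) θ).re)
        (Set.Icc (θ + π) (θ + 2 * π)) :=
      strictAntiOn_of_hasDerivWithinAt_neg (convex_Icc _ _) hcont.continuousOn
        (fun x _ => (γ.hasDerivAt_re_offset_pt θ x).hasDerivWithinAt) fun x hx => by
          rw [interior_Icc] at hx
          refine mul_neg_of_neg_of_pos ?_ (γ.speed_pos x)
          rw [← Real.sin_sub_two_pi]
          exact Real.sin_neg_of_neg_of_neg_pi_lt (by linarith [hx.2]) (by linarith [hx.1])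
    simpa [offset, γ.periodic_pt θ] using
      hanti ⟨h, hφ.2.le⟩ ⟨by linarith [Real.pi_pos], le_rfl⟩ hφ.2

end ConvexCurve

namespace ConvexCurve

/-! ### The double-layer potential of a convex curve -/

variable {γ : ConvexCurve} {z : ℂ} {f : ℂ → ℂ} {U : Set ℂ}

/-- The Cauchy kernel `i⁻¹ dσ / (σ - z)` of the curve, as a density in the parameter. -/
def kernel (γ : ConvexCurve) (z : ℂ) (θ : ℝ) : ℂ := γ.speed θ / γ.offset z θ

/-- The density of the angle under which the curve is seen from `z`; this is the kernel of the
double-layer potential. -/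
def angle (γ : ConvexCurve) (z : ℂ) (θ : ℝ) : ℝ := (γ.kernel z θ).re

/-- The Cauchy integral at `z` of a density `φ` on the curve. -/
def cauchy (γ : ConvexCurve) (φ : ℝ → ℂ) (z : ℂ) : ℂ :=
  (2 * π : ℂ)⁻¹ * ∫ θ in (0 : ℝ)..(2 * π), φ θ * γ.kernel z θ

lemma offset_ne_zero (hz : z ∈ γ.region) (θ : ℝ) : γ.offset z θ ≠ 0 := fun h => by
  simpa [h] using hz θ

lemma continuous_kernel (hz : z ∈ γ.region) : Continuous (γ.kernel z) :=
  (continuous_ofReal.comp γ.continuous_speed).div (γ.continuous_offset z) (offset_ne_zero hz)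

lemma periodic_angle (z : ℂ) : Function.Periodic (γ.angle z) (2 * π) := fun θ => by
  simp only [angle, kernel, γ.periodic_speed θ, γ.periodic_offset z θ]

lemma continuous_angle (hz : z ∈ γ.region) : Continuous (γ.angle z) :=
  continuous_re.comp (continuous_kernel hz)

lemma angle_nonneg (hz : z ∈ γ.region) (θ : ℝ) : 0 ≤ γ.angle z θ := by
  rw [angle, kernel, Complex.div_re, ofReal_re, ofReal_im, zero_mul, zero_div, add_zero]
  exact div_nonneg (mul_nonneg (γ.speed_pos θ).le (hz θ).le) (normSq_nonneg _)

lemma integral_kernel (hz : z ∈ γ.region) :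
    ∫ θ in (0 : ℝ)..(2 * π), γ.kernel z θ = 2 * π := by
  have hlog (θ : ℝ) : HasDerivAt (fun θ => Complex.log (γ.offset z θ))
      (-I + I * γ.kernel z θ) θ := by
    refine ((γ.hasDerivAt_offset z θ).clog_real (Or.inl (hz θ))).congr_deriv ?_
    have := offset_ne_zero hz θ
    rw [kernel]
    field_simp
  have hk := continuous_kernel hz
  have hintegral := integral_eq_sub_of_hasDerivAt (a := (0 : ℝ)) (b := 2 * π) (fun θ _ => hlog θ)
    (Continuous.intervalIntegrable (by fun_prop) _ _)
  have hper : γ.offset z (2 * π) = γ.offset z 0 := by simpa using γ.periodic_offset z 0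
  rw [hper, sub_self, integral_add intervalIntegrable_const
    (Continuous.intervalIntegrable (by fun_prop) _ _), intervalIntegral.integral_const,
    intervalIntegral.integral_const_mul, real_smul, sub_zero] at hintegral
  push_cast at hintegral
  exact mul_left_cancel₀ I_ne_zero (by linear_combination hintegral)

lemma integral_angle (hz : z ∈ γ.region) : ∫ θ in (0 : ℝ)..(2 * π), γ.angle z θ = 2 * π := by
  have h := reCLM.intervalIntegral_comp_comm
    ((continuous_kernel hz).intervalIntegrable (μ := volume) 0 (2 * π))
  rw [integral_kernel hz] at h
  simpa [angle] using h

/-- Cauchy's formula, from the existence of a primitive of `dslope f z` on the convex set `U`. -/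
lemma cauchy_eq (hU : Convex ℝ U) (hUo : IsOpen U) (hf : DifferentiableOn ℂ f U)
    (hin : γ.region ⊆ U) (hpt : ∀ θ, γ.pt θ ∈ U) (hz : z ∈ γ.region) :
    γ.cauchy (fun θ => f (γ.pt θ)) z = f z := by
  have hds : DifferentiableOn ℂ (dslope f z) U :=
    (Complex.differentiableOn_dslope (hUo.mem_nhds (hin hz))).2 hf
  obtain ⟨G, hG⟩ := hU.exists_forall_hasDerivWithinAt hds
  have hderiv (θ : ℝ) : HasDerivAt (fun θ => G (γ.pt θ))
      (dslope f z (γ.pt θ) * (I * cexp (θ * I) * γ.speed θ)) θ :=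
    ((hG _ (hpt θ)).hasDerivAt (hUo.mem_nhds (hpt θ))).comp θ (γ.hasDerivAt_pt θ)
  have hdsc : Continuous fun θ => dslope f z (γ.pt θ) :=
    hds.continuousOn.comp_continuous γ.continuous_pt hpt
  have hs := γ.continuous_speed
  have hk := continuous_kernel hz
  have hprim := integral_eq_sub_of_hasDerivAt (a := (0 : ℝ)) (b := 2 * π) (fun θ _ => hderiv θ)
    (Continuous.intervalIntegrable (by fun_prop) _ _)
  have hper : γ.pt (2 * π) = γ.pt 0 := by simpa using γ.periodic_pt 0
  rw [hper, sub_self] at hprim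
  have hsplit (θ : ℝ) : f (γ.pt θ) * γ.kernel z θ = f z * γ.kernel z θ +
      -I * (dslope f z (γ.pt θ) * (I * cexp (θ * I) * γ.speed θ)) := by
    have hne := offset_ne_zero hz θ
    have hslope := sub_smul_dslope f z (γ.pt θ)
    rw [smul_eq_mul, pt_sub_eq] at hslope
    rw [sub_eq_iff_eq_add'.1 hslope.symm, kernel]
    field_simp
    linear_combination (dslope f z (γ.pt θ)) * cexp (θ * I) * γ.offset z θ * γ.speed θ * I_sq
  rw [cauchy, integral_congr (fun θ _ => hsplit θ),
    integral_add (Continuous.intervalIntegrable (by fun_prop) _ _)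
      (Continuous.intervalIntegrable (by fun_prop) _ _),
    intervalIntegral.integral_const_mul, intervalIntegral.integral_const_mul, hprim,
    integral_kernel hz]
  have hpi : (π : ℂ) ≠ 0 := by exact_mod_cast Real.pi_ne_zero
  field_simp
  ring

lemma hasDerivAt_kernel (hz : z ∈ γ.region) (θ : ℝ) :
    HasDerivAt (fun z => γ.kernel z θ)
      (γ.speed θ * cexp (-(θ * I)) / (γ.offset z θ) ^ 2) z := by
  have hoffset : HasDerivAt (fun z => γ.offset z θ) (-cexp (-(θ * I))) z :=
    (((hasDerivAt_id z).const_sub (γ.pt θ)).const_mul _).congr_deriv (by ring)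
  exact ((hasDerivAt_const z (γ.speed θ : ℂ)).div hoffset (offset_ne_zero hz θ)).congr_deriv
    (by ring)

lemma differentiableOn_cauchy {φ : ℝ → ℂ} (hφ : Continuous φ) :
    DifferentiableOn ℂ (γ.cauchy φ) γ.region := by
  intro z₀ hz₀
  obtain ⟨R, hR⟩ := γ.exists_speed_le
  have hR₀ : 0 ≤ R := (γ.speed_pos 0).le.trans (hR 0)
  obtain ⟨d, hd, hball⟩ : ∃ d > 0, ∀ z ∈ Metric.ball z₀ d, d ≤ γ.depth z := by
    have hdepth := γ.mem_region_iff.1 hz₀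
    refine ⟨γ.depth z₀ / 2, by positivity, fun z hz => ?_⟩
    linarith [γ.depth_le_depth_add_dist z₀ z, Metric.mem_ball'.1 hz]
  have hregion : ∀ z ∈ Metric.ball z₀ d, z ∈ γ.region := fun z hz =>
    γ.mem_region_iff.2 (hd.trans_le (hball z hz))
  have hs := γ.continuous_speed
  have hk₀ := continuous_kernel hz₀
  refine (DifferentiableAt.const_mul ?_ _).differentiableWithinAt
  refine (hasDerivAt_integral_of_dominated_loc_of_deriv_le
    (F' := fun z θ => φ θ * (γ.speed θ * cexp (-(θ * I)) / (γ.offset z θ) ^ 2))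
    (s := Metric.ball z₀ d) (bound := fun θ => ‖φ θ‖ * (R / d ^ 2))
    (Metric.ball_mem_nhds _ hd) ?_ (Continuous.intervalIntegrable (by fun_prop) _ _) ?_ ?_
    (Continuous.intervalIntegrable (by fun_prop) _ _) ?_).2.differentiableAt
  · filter_upwards [Metric.ball_mem_nhds z₀ hd] with z hz
    have hk := continuous_kernel (hregion z hz)
    exact Continuous.aestronglyMeasurable (by fun_prop)
  · have hk' : Continuous fun θ : ℝ => γ.speed θ * cexp (-(θ * I)) / γ.offset z₀ θ ^ 2 :=
      Continuous.div (by fun_prop) (by fun_prop) fun θ => pow_ne_zero _ (offset_ne_zero hz₀ θ)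
    exact Continuous.aestronglyMeasurable (by fun_prop)
  · refine Eventually.of_forall fun θ _ z hz => ?_
    rw [norm_mul, norm_div, norm_mul, norm_exp_neg_mul_I, mul_one, norm_pow, norm_real,
      Real.norm_of_nonneg (γ.speed_pos θ).le]
    have hdθ := (hball z hz).trans (γ.depth_le_norm_offset z θ)
    gcongr
    exact hR θ
  · exact Eventually.of_forall fun θ _ z hz =>
      (hasDerivAt_kernel (hregion z hz) θ).const_mul _

lemma cauchy_add_conj {φ : ℝ → ℂ} (hφ : Continuous φ) (hz : z ∈ γ.region) :
    γ.cauchy φ z + conj (γ.cauchy (fun θ => conj (φ θ)) z) =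
      (π : ℂ)⁻¹ * ∫ θ in (0 : ℝ)..(2 * π), φ θ * γ.angle z θ := by
  have hk := continuous_kernel hz
  have hsplit (θ : ℝ) : φ θ * γ.angle z θ =
      2⁻¹ * (φ θ * γ.kernel z θ + φ θ * conj (γ.kernel z θ)) := by
    rw [← mul_add, Complex.add_conj, angle]
    push_cast
    ring
  simp only [hsplit, cauchy, intervalIntegral.integral_const_mul]
  rw [integral_add (Continuous.intervalIntegrable (by fun_prop) _ _)
      (Continuous.intervalIntegrable (by fun_prop) _ _), map_mul, ← intervalIntegral_conj]
  simp only [map_mul, map_inv₀, map_ofNat, conj_ofReal, conj_conj]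
  ring

lemma integral_angle_le_pi (hz : z ∈ γ.region) {θ₀ a b : ℝ}
    (harc : ∀ θ ∈ Set.uIcc a b, (γ.offset z θ₀).re < (γ.offset (γ.pt θ) θ₀).re) :
    ∫ θ in a..b, γ.angle z θ ≤ π := by
  have hpos : ∀ θ ∈ Set.uIcc a b, 0 < (cexp (-(θ₀ * I)) * (z - γ.pt θ)).re := fun θ hθ => by
    rw [← offset_sub_offset, sub_re]
    exact sub_pos.2 (harc θ hθ)
  have hlog : ∀ θ ∈ Set.uIcc a b, HasDerivAt
      (fun θ => Complex.log (cexp (-(θ₀ * I)) * (z - γ.pt θ))) (I * γ.kernel z θ) θ := by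
    intro θ hθ
    refine ((((γ.hasDerivAt_pt θ).const_sub z).const_mul _).clog_real
      (Or.inl (hpos θ hθ))).congr_deriv ?_
    have hne := offset_ne_zero hz θ
    have hexp₀ := Complex.exp_ne_zero (-(θ₀ * I))
    rw [← neg_sub (γ.pt θ), pt_sub_eq, kernel]
    field_simp
  have hintegral := (continuous_kernel hz).intervalIntegrable (μ := volume) a b
  have hprim := integral_eq_sub_of_hasDerivAt hlog (hintegral.const_mul I)
  have hre := reCLM.intervalIntegral_comp_comm hintegral
  have him := congrArg Complex.im hprim
  rw [intervalIntegral.integral_const_mul, I_mul_im, sub_im, log_im, log_im] at him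
  simp only [reCLM_apply] at hre
  simp only [angle, hre, him]
  have ha := abs_lt.1 (Complex.abs_arg_lt_pi_div_two_iff.2 (Or.inl (hpos _ Set.left_mem_uIcc)))
  have hb := abs_lt.1 (Complex.abs_arg_lt_pi_div_two_iff.2 (Or.inl (hpos _ Set.right_mem_uIcc)))
  linarith [ha.1, hb.2]

lemma norm_integral_mul_angle_le (hz : z ∈ γ.region) {φ : ℝ → ℂ} {C a b : ℝ} (hab : a ≤ b)
    (hφ : ∀ θ ∈ Set.Icc a b, ‖φ θ‖ ≤ C) :
    ‖∫ θ in a..b, φ θ * γ.angle z θ‖ ≤ C * ∫ θ in a..b, γ.angle z θ := by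
  rw [← intervalIntegral.integral_const_mul]
  refine norm_integral_le_of_norm_le hab (Eventually.of_forall fun θ hθ => ?_)
    (((continuous_angle hz).intervalIntegrable _ _).const_mul C)
  rw [norm_mul, norm_real, Real.norm_of_nonneg (angle_nonneg hz θ)]
  exact mul_le_mul_of_nonneg_right (hφ θ (Set.Ioc_subset_Icc_self hθ)) (angle_nonneg hz θ)

lemma continuous_mul_angle (hf : ContinuousOn f U) (hpt : ∀ θ, γ.pt θ ∈ U) (hz : z ∈ γ.region) :
    Continuous fun θ => f (γ.pt θ) * γ.angle z θ :=
  (hf.comp_continuous γ.continuous_pt hpt).mul (continuous_ofReal.comp (continuous_angle hz))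

lemma pi_mul_conj_cauchy_conj (hU : Convex ℝ U) (hUo : IsOpen U) (hf : DifferentiableOn ℂ f U)
    (hin : γ.region ⊆ U) (hpt : ∀ θ, γ.pt θ ∈ U) (hz : z ∈ γ.region) (a : ℝ) :
    π * conj (γ.cauchy (fun θ => conj (f (γ.pt θ))) z) =
      (∫ θ in a..a + 2 * π, f (γ.pt θ) * γ.angle z θ) - π * f z := by
  have hper : Function.Periodic (fun θ => f (γ.pt θ) * γ.angle z θ) (2 * π) := fun θ => by
    simp only [γ.periodic_pt θ, periodic_angle z θ]
  have hfc : Continuous fun θ => f (γ.pt θ) :=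
    hf.continuousOn.comp_continuous γ.continuous_pt hpt
  have hsum := cauchy_add_conj hfc hz
  rw [cauchy_eq hU hUo hf hin hpt hz] at hsum
  rw [eq_sub_of_add_eq' hsum, hper.intervalIntegral_add_eq a 0, zero_add]
  have hpi : (π : ℂ) ≠ 0 := by exact_mod_cast Real.pi_ne_zero
  field_simp

/-- The angle under which the arc away from `pt θ₀` is seen is at most `π`, so that the mass near
`pt θ₀`, where `f` is almost `f z`, exceeds `π` by just as much as the far mass falls short of
it. -/
lemma norm_cauchy_conj_le_of_near (hU : Convex ℝ U) (hUo : IsOpen U)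
    (hf : DifferentiableOn ℂ f U) (hin : γ.region ⊆ U) (hpt : ∀ θ, γ.pt θ ∈ U)
    (hf1 : ∀ z ∈ U, ‖f z‖ ≤ 1) (hz : z ∈ γ.region) {θ₀ r ε : ℝ} (hr : 0 < r) (hrπ : r < π)
    (hnear : ∀ θ ∈ Set.Icc (θ₀ - r) (θ₀ + r), ‖f (γ.pt θ) - f z‖ ≤ ε)
    (hfar : ∀ θ ∈ Set.Icc (θ₀ + r) (θ₀ - r + 2 * π),
      (γ.offset z θ₀).re < (γ.offset (γ.pt θ) θ₀).re) :
    ‖γ.cauchy (fun θ => conj (f (γ.pt θ))) z‖ ≤ 1 + 2 * ε := by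
  have hle : θ₀ + r ≤ θ₀ - r + 2 * π := by linarith
  have hε : 0 ≤ ε := (norm_nonneg _).trans (hnear θ₀ ⟨by linarith, by linarith⟩)
  have hac := continuous_angle hz
  have hintegral (a b : ℝ) : IntervalIntegrable (fun θ => f (γ.pt θ) * γ.angle z θ) volume a b :=
    (continuous_mul_angle hf.continuousOn hpt hz).intervalIntegrable a b
  have hg := pi_mul_conj_cauchy_conj hU hUo hf hin hpt hz (θ₀ - r)
  have hmass := (periodic_angle (γ := γ) z).intervalIntegral_add_eq (θ₀ - r) 0
  rw [← integral_add_adjacent_intervals (hintegral _ (θ₀ + r)) (hintegral _ _)] at hg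
  rw [zero_add, integral_angle hz, ← integral_add_adjacent_intervals
    (hac.intervalIntegrable _ (θ₀ + r)) (hac.intervalIntegrable _ _)] at hmass
  have hfarMass : ∫ θ in (θ₀ + r)..(θ₀ - r + 2 * π), γ.angle z θ ≤ π :=
    integral_angle_le_pi hz (by rwa [Set.uIcc_of_le hle])
  have hfarNorm := norm_integral_mul_angle_le hz hle fun θ _ => hf1 _ (hpt θ)
  have hnearNorm := norm_integral_mul_angle_le hz (by linarith : θ₀ - r ≤ θ₀ + r) hnear
  simp only [sub_mul] at hnearNorm
  rw [intervalIntegral.integral_sub (hintegral _ _)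
      (Continuous.intervalIntegrable (by fun_prop) _ _),
    intervalIntegral.integral_const_mul, intervalIntegral.integral_ofReal] at hnearNorm
  set near := ∫ θ in (θ₀ - r)..(θ₀ + r), γ.angle z θ
  set far := ∫ θ in (θ₀ + r)..(θ₀ - r + 2 * π), γ.angle z θ
  set nearInt := ∫ θ in (θ₀ - r)..(θ₀ + r), f (γ.pt θ) * γ.angle z θ
  set farInt := ∫ θ in (θ₀ + r)..(θ₀ - r + 2 * π), f (γ.pt θ) * γ.angle z θ
  set g := γ.cauchy (fun θ => conj (f (γ.pt θ))) z
  have hexcess : ‖f z * ((near - π : ℝ) : ℂ)‖ ≤ near - π := by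
    rw [norm_mul, norm_real, Real.norm_of_nonneg (by linarith)]
    exact mul_le_of_le_one_left (by linarith) (hf1 _ (hin hz))
  have hbound : π * ‖g‖ ≤ ε * near + (near - π) + 1 * far := by
    calc π * ‖g‖ = ‖(π : ℂ) * conj g‖ := by
          rw [norm_mul, norm_real, Real.norm_of_nonneg Real.pi_pos.le, RCLike.norm_conj]
      _ = ‖(nearInt - f z * near) + f z * ((near - π : ℝ) : ℂ) + farInt‖ := by
          rw [hg]
          push_cast
          ring_nf
      _ ≤ _ := norm_add₃_le.trans (by gcongr)
  have hfar₀ : 0 ≤ far := integral_nonneg hle fun θ _ => angle_nonneg hz θ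
  have hεnear : ε * near ≤ ε * (2 * π) := by
    gcongr
    linarith
  exact le_of_mul_le_mul_left (by linarith) Real.pi_pos

lemma eventually_norm_cauchy_conj_le (hU : Convex ℝ U) (hUo : IsOpen U)
    (hf : DifferentiableOn ℂ f U) (hin : γ.region ⊆ U) (hpt : ∀ θ, γ.pt θ ∈ U)
    (hf1 : ∀ z ∈ U, ‖f z‖ ≤ 1) {η : ℝ} (hη : 0 < η) (θ₀ : ℝ) :
    ∀ᶠ z in 𝓝 (γ.pt θ₀), z ∈ γ.region →
      ‖γ.cauchy (fun θ => conj (f (γ.pt θ))) z‖ ≤ 1 + η := by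
  have hfc : ContinuousAt f (γ.pt θ₀) :=
    (hf.differentiableAt (hUo.mem_nhds (hpt θ₀))).continuousAt
  have hnear : ∀ᶠ z in 𝓝 (γ.pt θ₀), ‖f z - f (γ.pt θ₀)‖ ≤ η / 4 := by
    filter_upwards [hfc.eventually (Metric.closedBall_mem_nhds _ (by positivity : 0 < η / 4))]
      with z hz
    rwa [← dist_eq_norm]
  obtain ⟨ρ, hρ, hρnear⟩ := Metric.nhds_basis_closedBall.eventually_iff.1
    (γ.continuous_pt.continuousAt.eventually hnear)
  set r := min ρ 1
  have hr : 0 < r := by positivity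
  have hrπ : r < π := (min_le_right _ _).trans_lt (by linarith [Real.pi_gt_three])
  obtain ⟨θ₁, hθ₁, hmin⟩ := (isCompact_Icc (a := θ₀ + r) (b := θ₀ - r + 2 * π)).exists_isMinOn
    ⟨θ₀ + r, le_rfl, by linarith⟩
    (f := fun θ => (γ.offset (γ.pt θ) θ₀).re) (by unfold offset; fun_prop)
  have hc : (γ.offset (γ.pt θ₀) θ₀).re < (γ.offset (γ.pt θ₁) θ₀).re := by
    simpa [offset] using γ.re_offset_pt_pos ⟨by linarith [hθ₁.1], by linarith [hθ₁.2]⟩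
  have hfar : ∀ᶠ z in 𝓝 (γ.pt θ₀), (γ.offset z θ₀).re < (γ.offset (γ.pt θ₁) θ₀).re :=
    ContinuousAt.eventually_lt (by unfold offset; fun_prop) continuousAt_const hc
  filter_upwards [hnear, hfar] with z hznear hzfar hz
  refine (norm_cauchy_conj_le_of_near hU hUo hf hin hpt hf1 hz hr hrπ (ε := η / 2)
    (fun θ hθ => ?_) fun θ hθ => hzfar.trans_le (hmin hθ)).trans_eq (by ring)
  have hθρ : θ ∈ Metric.closedBall θ₀ ρ := by
    rw [Real.closedBall_eq_Icc]
    have := min_le_left ρ 1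
    exact ⟨by linarith [hθ.1], by linarith [hθ.2]⟩
  calc ‖f (γ.pt θ) - f z‖ ≤ ‖f (γ.pt θ) - f (γ.pt θ₀)‖ + ‖f (γ.pt θ₀) - f z‖ :=
        norm_sub_le_norm_sub_add_norm_sub ..
    _ ≤ η / 4 + η / 4 := add_le_add (hρnear hθρ) (by rwa [norm_sub_rev])
    _ = η / 2 := by ring

theorem norm_cauchy_conj_le (hU : Convex ℝ U) (hUo : IsOpen U) (hf : DifferentiableOn ℂ f U)
    (hin : γ.region ⊆ U) (hpt : ∀ θ, γ.pt θ ∈ U) (hf1 : ∀ z ∈ U, ‖f z‖ ≤ 1)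
    (hz : z ∈ γ.region) : ‖γ.cauchy (fun θ => conj (f (γ.pt θ))) z‖ ≤ 1 := by
  refine le_of_forall_pos_le_add fun η hη => ?_
  have hnhds : {z | z ∈ γ.region → ‖γ.cauchy (fun θ => conj (f (γ.pt θ))) z‖ ≤ 1 + η} ∈
      𝓝ˢ (Set.range γ.pt) := mem_nhdsSet_iff_forall.2 <| Set.forall_mem_range.2
    (eventually_norm_cauchy_conj_le hU hUo hf hin hpt hf1 hη)
  obtain ⟨δ₀, hδ₀, hδ₀sub⟩ :=
    (Metric.hasBasis_nhdsSet_cthickening γ.isCompact_range_pt).mem_iff.1 hnhds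
  have hdepth := γ.mem_region_iff.1 hz
  obtain ⟨δ, hδ, hδδ₀, hδz⟩ : ∃ δ > 0, δ ≤ δ₀ ∧ δ < γ.depth z :=
    ⟨min δ₀ (γ.depth z / 2), by positivity, min_le_left _ _,
      (min_le_right _ _).trans_lt (half_lt_self hdepth)⟩
  have hclosure : closure {z | δ < γ.depth z} ⊆ {z | δ ≤ γ.depth z} :=
    closure_lt_subset_le continuous_const γ.continuous_depth
  have hregion : {z | δ ≤ γ.depth z} ⊆ γ.region := fun w hw =>
    γ.mem_region_iff.2 (hδ.trans_le hw)
  have hfc : Continuous fun θ => conj (f (γ.pt θ)) :=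
    Complex.continuous_conj.comp (hf.continuousOn.comp_continuous γ.continuous_pt hpt)
  refine Complex.norm_le_of_forall_mem_frontier_norm_le (U := {z | δ < γ.depth z})
    (γ.isBounded_region.subset (subset_closure.trans (hclosure.trans hregion)))
    ((differentiableOn_cauchy hfc).mono (hclosure.trans hregion)).diffContOnCl
    (fun w hw => ?_) (subset_closure hδz)
  have hwδ : δ = γ.depth w := frontier_lt_subset_eq continuous_const γ.continuous_depth hw
  obtain ⟨θ, hθ⟩ := γ.exists_pt_sub_eq_depth_mul w
  refine hδ₀sub (Metric.mem_cthickening_of_dist_le w (γ.pt θ) δ₀ _ ⟨θ, rfl⟩ ?_)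
    (hregion hwδ.le)
  rw [dist_comm, dist_eq_norm, hθ, norm_mul, norm_exp_ofReal_mul_I, one_mul, ← hwδ, norm_real,
    Real.norm_of_nonneg hδ.le]
  exact hδδ₀

end ConvexCurve

/-! ### The Crouzeix–Palencia theorem for operators with simple spectrum -/

section InterpEval

open Polynomial

variable {A : Type*} [Ring A] [Algebra ℂ A] {a : A} {S : Finset ℂ}

/-- The functional calculus of an element `a` annihilated by `∏ μ ∈ S, (X - μ)`: the value at `a`
of the polynomial interpolating `f` on `S`. -/
def interpEval (a : A) (S : Finset ℂ) (f : ℂ → ℂ) : A := aeval a (Lagrange.interpolate S id f)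

lemma interpEval_eq_sum (f : ℂ → ℂ) :
    interpEval a S f = ∑ μ ∈ S, f μ • aeval a (Lagrange.basis S id μ) := by
  simp only [interpEval, Lagrange.interpolate_apply, map_sum, map_mul, aeval_C, Algebra.smul_def]

lemma interpEval_congr {f g : ℂ → ℂ} (h : ∀ μ ∈ S, f μ = g μ) :
    interpEval a S f = interpEval a S g := by
  simp only [interpEval_eq_sum]
  exact Finset.sum_congr rfl fun μ hμ => by rw [h μ hμ]

lemma interpEval_eval (ha : aeval a (Lagrange.nodal S id) = 0) (p : ℂ[X]) :
    interpEval a S (fun z => p.eval z) = aeval a p := by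
  rw [interpEval, ← sub_eq_zero, ← map_sub]
  refine aeval_eq_zero_of_dvd_aeval_eq_zero (Finset.prod_dvd_of_coprime
    (fun x _ y _ hxy => isCoprime_X_sub_C_of_isUnit_sub (sub_ne_zero.2 hxy).isUnit)
    fun μ hμ => dvd_iff_isRoot.2 ?_) ha
  have heval : (Lagrange.interpolate S id fun z => p.eval z).eval μ = p.eval μ :=
    Lagrange.eval_interpolate_at_node _ (Set.injOn_id _) hμ
  rw [id, IsRoot, eval_sub, heval, sub_self]

lemma interpEval_one (ha : aeval a (Lagrange.nodal S id) = 0) :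
    interpEval a S (fun _ => 1) = 1 := by
  simpa using interpEval_eval ha 1

lemma interpEval_mul (ha : aeval a (Lagrange.nodal S id) = 0) (f g : ℂ → ℂ) :
    interpEval a S f * interpEval a S g = interpEval a S fun z => f z * g z := by
  rw [interpEval, interpEval, ← map_mul, ← interpEval_eval ha]
  refine interpEval_congr fun μ hμ => ?_
  have heval (h : ℂ → ℂ) : (Lagrange.interpolate S id h).eval μ = h μ :=
    Lagrange.eval_interpolate_at_node h (Set.injOn_id _) hμ
  rw [eval_mul, heval, heval]

lemma tendsto_interpEval [TopologicalSpace A] [ContinuousAdd A] [ContinuousSMul ℂ A]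
    {α : Type*} {l : Filter α} {f : α → ℂ → ℂ} {g : ℂ → ℂ}
    (h : ∀ μ ∈ S, Tendsto (f · μ) l (𝓝 (g μ))) :
    Tendsto (fun t => interpEval a S (f t)) l (𝓝 (interpEval a S g)) := by
  simp only [interpEval_eq_sum]
  exact tendsto_finsetSum _ fun μ hμ => (h μ hμ).smul_const _

lemma norm_interpEval_le_sum {A : Type*} [NormedRing A] [NormedAlgebra ℂ A] {a : A} {f : ℂ → ℂ}
    (hf : ∀ μ ∈ S, ‖f μ‖ ≤ 1) :
    ‖interpEval a S f‖ ≤ ∑ μ ∈ S, ‖aeval a (Lagrange.basis S id μ)‖ := by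
  rw [interpEval_eq_sum]
  refine norm_sum_le_of_le _ fun μ hμ => ?_
  rw [norm_smul]
  exact mul_le_of_le_one_left (norm_nonneg _) (hf μ hμ)

end InterpEval

section Accretive

variable {V : Type*} [NormedAddCommGroup V] [InnerProductSpace ℂ V]

/-- The arithmetic-geometric mean form of the Cauchy–Schwarz inequality for the semi-inner product
`⟪y, N x⟫ + ⟪N y, x⟫`. -/
lemma norm_inner_add_inner_le_of_accretive (N : V →ₗ[ℂ] V)
    (hN : ∀ x, 0 ≤ (inner ℂ x (N x)).re) (x y : V) :
    ‖inner ℂ y (N x) + inner ℂ (N y) x‖ ≤ (inner ℂ x (N x)).re + (inner ℂ y (N y)).re := by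
  set b := inner ℂ y (N x) + inner ℂ (N y) x with hb
  obtain ⟨c, hc, hcb⟩ : ∃ c : ℂ, conj c * c = 1 ∧ conj c * b = ‖b‖ := by
    have hunit : conj (cexp (b.arg * I)) * cexp (b.arg * I) = 1 := by
      rw [mul_comm, Complex.mul_conj, normSq_eq_norm_sq, norm_exp_ofReal_mul_I]
      simp
    exact ⟨cexp (b.arg * I), hunit, by
      linear_combination -conj (cexp (b.arg * I)) * norm_mul_exp_arg_mul_I b + ‖b‖ * hunit⟩
  have hexp : inner ℂ (x - c • y) (N (x - c • y)) = inner ℂ x (N x) - c * inner ℂ x (N y)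
      - conj c * inner ℂ y (N x) + inner ℂ y (N y) := by
    rw [map_sub, map_smul, inner_sub_left, inner_sub_right, inner_sub_right, inner_smul_right,
      inner_smul_left, inner_smul_left, inner_smul_right]
    linear_combination (inner ℂ y (N y)) * hc
  have hre : (c * inner ℂ x (N y)).re = (conj c * inner ℂ (N y) x).re := by
    rw [← conj_re, map_mul, inner_conj_symm]
  have hsum : (conj c * inner ℂ (N y) x).re + (conj c * inner ℂ y (N x)).re = ‖b‖ := by
    rw [← add_re, ← mul_add, add_comm (inner ℂ (N y) x), ← hb, hcb, ofReal_re]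
  have hpos := hN (x - c • y)
  rw [hexp, add_re, sub_re, sub_re, hre] at hpos
  linarith

lemma opNorm_le_two_of_norm_inner_le (L : V →L[ℂ] V)
    (h : ∀ x y, ‖inner ℂ y (L x)‖ ≤ ‖x‖ ^ 2 + ‖y‖ ^ 2) : ‖L‖ ≤ 2 := by
  refine L.opNorm_le_bound zero_le_two fun x => ?_
  rcases eq_or_ne (L x) 0 with hLx | hLx
  · rw [hLx, norm_zero]
    positivity
  have hL : 0 < ‖L x‖ := norm_pos_iff.2 hLx
  have hx : 0 < ‖x‖ := norm_pos_iff.2 fun hx => hLx (by rw [hx, map_zero])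
  have hscaled := h x (((‖x‖ / ‖L x‖ : ℝ) : ℂ) • L x)
  rw [inner_smul_left, inner_self_eq_norm_sq_to_K, norm_smul, conj_ofReal, norm_mul, norm_real,
    norm_pow, Real.norm_of_nonneg (by positivity), div_mul_cancel₀ _ hL.ne', pow_two ‖_‖,
    ← mul_assoc, norm_algebraMap', norm_norm, div_mul_cancel₀ _ hL.ne'] at hscaled
  exact le_of_mul_le_mul_left (by linarith) hx

end Accretive

section CrouzeixPalencia

open Polynomial

variable {V : Type*} [NormedAddCommGroup V] [InnerProductSpace ℂ V]

/-- The numerical range of `T` lies in the closed domain bounded by the curve: the real part of the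
offset, evaluated at `T`, is a nonnegative operator for each of the supporting lines. -/
def ConvexCurve.Encloses (γ : ConvexCurve) (T : V →L[ℂ] V) : Prop :=
  ∀ (θ : ℝ) (x : V), 0 ≤ (inner ℂ x (cexp (-(θ * I)) • (γ.pt θ • x - T x))).re

/-- The Cauchy kernel of the curve evaluated at an operator with spectrum in `S`. -/
def kernelOp (γ : ConvexCurve) (T : V →L[ℂ] V) (S : Finset ℂ) (θ : ℝ) : V →L[ℂ] V :=
  interpEval T S fun z => γ.kernel z θ

variable {γ : ConvexCurve} {T : V →L[ℂ] V} {S : Finset ℂ} {U : Set ℂ} {f : ℂ → ℂ}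

lemma offset_kernelOp (hT : aeval T (Lagrange.nodal S id) = 0) (hS : ∀ μ ∈ S, μ ∈ γ.region)
    (θ : ℝ) (x : V) :
    cexp (-(θ * I)) • (γ.pt θ • kernelOp γ T S θ x - T (kernelOp γ T S θ x)) = γ.speed θ • x := by
  have hoffset : interpEval T S (fun z => γ.offset z θ) =
      aeval T (C (cexp (-(θ * I))) * (C (γ.pt θ) - X)) := by
    rw [← interpEval_eval hT]
    simp [ConvexCurve.offset]
  have hmul : interpEval T S (fun z => γ.offset z θ) * kernelOp γ T S θ =
      aeval T (C (γ.speed θ : ℂ)) := by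
    rw [kernelOp, interpEval_mul hT, ← interpEval_eval hT]
    refine interpEval_congr fun μ hμ => ?_
    rw [ConvexCurve.kernel, mul_div_cancel₀ _ (ConvexCurve.offset_ne_zero (hS μ hμ) θ), eval_C]
  rw [hoffset] at hmul
  simpa [Algebra.algebraMap_eq_smul_one] using congr($hmul x)

lemma re_inner_kernelOp_nonneg (hT : aeval T (Lagrange.nodal S id) = 0)
    (hS : ∀ μ ∈ S, μ ∈ γ.region) (hγ : γ.Encloses T) (θ : ℝ) (x : V) :
    0 ≤ (inner ℂ x (kernelOp γ T S θ x)).re := by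
  have h := hγ θ (kernelOp γ T S θ x)
  rw [offset_kernelOp hT hS, inner_smul_right_eq_smul, smul_re, ← inner_conj_symm, conj_re] at h
  exact nonneg_of_mul_nonneg_right h (γ.speed_pos θ)

lemma continuous_kernelOp (hS : ∀ μ ∈ S, μ ∈ γ.region) : Continuous (kernelOp γ T S) :=
  continuous_iff_continuousAt.2 fun _ => tendsto_interpEval fun μ hμ =>
    (ConvexCurve.continuous_kernel (hS μ hμ)).continuousAt

lemma inner_interpEval_cauchy (hS : ∀ μ ∈ S, μ ∈ γ.region) {φ : ℝ → ℂ} (hφ : Continuous φ)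
    (x y : V) :
    inner ℂ y (interpEval T S (γ.cauchy φ) x) =
      (2 * π : ℂ)⁻¹ * ∫ θ in (0 : ℝ)..(2 * π), φ θ * inner ℂ y (kernelOp γ T S θ x) := by
  have hinner (g : ℂ → ℂ) : inner ℂ y (interpEval T S g x) =
      ∑ μ ∈ S, g μ * inner ℂ y (aeval T (Lagrange.basis S id μ) x) := by
    simp only [interpEval_eq_sum, sum_apply, smul_apply, inner_sum, inner_smul_right]
  simp only [kernelOp, hinner, Finset.mul_sum, ← mul_assoc]
  rw [intervalIntegral.integral_finsetSum fun μ hμ => ((hφ.fun_mul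
    (ConvexCurve.continuous_kernel (hS μ hμ))).fun_mul continuous_const).intervalIntegrable _ _,
    Finset.mul_sum]
  simp only [intervalIntegral.integral_mul_const, ConvexCurve.cauchy, ← mul_assoc]

lemma integral_re_inner_kernelOp (hT : aeval T (Lagrange.nodal S id) = 0)
    (hS : ∀ μ ∈ S, μ ∈ γ.region) (x : V) :
    ∫ θ in (0 : ℝ)..(2 * π), (inner ℂ x (kernelOp γ T S θ x)).re = 2 * π * ‖x‖ ^ 2 := by
  have hone : interpEval T S (γ.cauchy fun _ => 1) = 1 := by
    rw [← interpEval_one hT]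
    exact interpEval_congr fun μ hμ => ConvexCurve.cauchy_eq (f := fun _ => 1) convex_univ
      isOpen_univ (differentiableOn_const 1) (Set.subset_univ _) (fun _ => Set.mem_univ _) (hS μ hμ)
  have h := inner_interpEval_cauchy (T := T) hS (φ := fun _ => 1) continuous_const x x
  have hpi : (2 * π : ℂ) ≠ 0 := by simp [Real.pi_ne_zero]
  simp only [hone, one_apply_eq_self, one_mul, inner_self_eq_norm_sq_to_K,
    eq_inv_mul_iff_mul_eq₀ hpi] at h
  have hcont : Continuous fun θ => inner ℂ x (kernelOp γ T S θ x) :=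
    continuous_const.inner ((continuous_kernelOp hS).clm_apply continuous_const)
  have hre := reCLM.intervalIntegral_comp_comm (hcont.intervalIntegrable (μ := volume) 0 (2 * π))
  simp only [reCLM_apply, ← h] at hre
  rw [hre, ← ofReal_re (2 * π * ‖x‖ ^ 2)]
  push_cast
  rfl

variable [CompleteSpace V]

lemma inner_interpEval_add_star (hS : ∀ μ ∈ S, μ ∈ γ.region) (hU : Convex ℝ U) (hUo : IsOpen U)
    (hf : DifferentiableOn ℂ f U) (hin : γ.region ⊆ U) (hpt : ∀ θ, γ.pt θ ∈ U) (x y : V) :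
    inner ℂ y ((interpEval T S f +
        star (interpEval T S (γ.cauchy fun θ => conj (f (γ.pt θ))))) x) =
      (2 * π : ℂ)⁻¹ * ∫ θ in (0 : ℝ)..(2 * π), f (γ.pt θ) *
        (inner ℂ y (kernelOp γ T S θ x) + inner ℂ (kernelOp γ T S θ y) x) := by
  have hfc : Continuous fun θ => f (γ.pt θ) :=
    hf.continuousOn.comp_continuous γ.continuous_pt hpt
  have hfc' : Continuous fun θ => conj (f (γ.pt θ)) := continuous_conj.comp hfc
  have hfcauchy : interpEval T S f = interpEval T S (γ.cauchy fun θ => f (γ.pt θ)) :=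
    interpEval_congr fun μ hμ => (ConvexCurve.cauchy_eq hU hUo hf hin hpt (hS μ hμ)).symm
  have hker (v : V) : Continuous fun θ => kernelOp γ T S θ v :=
    (continuous_kernelOp hS).clm_apply continuous_const
  rw [add_apply, inner_add_right, ContinuousLinearMap.star_eq_adjoint,
    ContinuousLinearMap.adjoint_inner_right, ← inner_conj_symm _ x, hfcauchy,
    inner_interpEval_cauchy hS hfc, inner_interpEval_cauchy hS hfc', map_mul,
    ← intervalIntegral_conj]
  simp only [map_mul, map_inv₀, map_ofNat, conj_ofReal, conj_conj, inner_conj_symm]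
  rw [← mul_add, ← intervalIntegral.integral_add
    ((hfc.fun_mul (continuous_const.inner (hker x))).intervalIntegrable _ _)
    ((hfc.fun_mul ((hker y).inner continuous_const)).intervalIntegrable _ _)]
  simp only [mul_add]

lemma norm_interpEval_add_star_le (hT : aeval T (Lagrange.nodal S id) = 0)
    (hS : ∀ μ ∈ S, μ ∈ γ.region) (hγ : γ.Encloses T) (hU : Convex ℝ U) (hUo : IsOpen U)
    (hf : DifferentiableOn ℂ f U) (hin : γ.region ⊆ U) (hpt : ∀ θ, γ.pt θ ∈ U)
    (hf1 : ∀ z ∈ U, ‖f z‖ ≤ 1) :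
    ‖interpEval T S f + star (interpEval T S (γ.cauchy fun θ => conj (f (γ.pt θ))))‖ ≤ 2 := by
  refine opNorm_le_two_of_norm_inner_le _ fun x y => ?_
  have hre (v : V) : Continuous fun θ => (inner ℂ v (kernelOp γ T S θ v)).re :=
    continuous_re.comp <| continuous_const.inner <|
      (continuous_kernelOp hS).clm_apply continuous_const
  have hpi : ‖(2 * π : ℂ)‖ = 2 * π := by
    rw [← ofReal_ofNat, ← ofReal_mul, Complex.norm_of_nonneg Real.two_pi_pos.le]
  rw [inner_interpEval_add_star hS hU hUo hf hin hpt, norm_mul, norm_inv, hpi,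
    inv_mul_le_iff₀ Real.two_pi_pos]
  calc _ ≤ ∫ θ in (0 : ℝ)..(2 * π),
        ((inner ℂ x (kernelOp γ T S θ x)).re + (inner ℂ y (kernelOp γ T S θ y)).re) := by
        refine intervalIntegral.norm_integral_le_of_norm_le Real.two_pi_pos.le
          (Eventually.of_forall fun θ _ => ?_) (((hre x).add (hre y)).intervalIntegrable _ _)
        rw [norm_mul]
        exact (mul_le_of_le_one_left (norm_nonneg _) (hf1 _ (hpt θ))).trans <|
          norm_inner_add_inner_le_of_accretive (kernelOp γ T S θ : V →ₗ[ℂ] V)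
            (re_inner_kernelOp_nonneg hT hS hγ θ) x y
    _ = 2 * π * (‖x‖ ^ 2 + ‖y‖ ^ 2) := by
        rw [intervalIntegral.integral_add ((hre x).intervalIntegrable _ _)
          ((hre y).intervalIntegrable _ _), integral_re_inner_kernelOp hT hS,
          integral_re_inner_kernelOp hT hS, mul_add]

end CrouzeixPalencia

lemma norm_pow_four_le {A : Type*} [NormedRing A] [StarRing A] [CStarRing A] (a g : A) :
    ‖a‖ ^ 4 ≤ ‖a + star g‖ * ‖a‖ ^ 3 + ‖a * g * a‖ * ‖a‖ := by
  have hsplit : a * star a * (a * star a) =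
      a * star (a + star g) * (a * star a) - a * g * a * star a := by
    rw [star_add, star_star]
    noncomm_ring
  calc ‖a‖ ^ 4 = ‖a * star a * (a * star a)‖ := by
        rw [(IsSelfAdjoint.mul_star_self a).norm_mul_self, CStarRing.norm_self_mul_star]
        ring
    _ ≤ ‖a * star (a + star g) * (a * star a)‖ + ‖a * g * a * star a‖ := hsplit ▸ norm_sub_le _ _
    _ ≤ ‖a‖ * ‖star (a + star g)‖ * (‖a‖ * ‖star a‖) + ‖a * g * a‖ * ‖star a‖ := by
        gcongr
        · exact (norm_mul_le _ _).trans (mul_le_mul (norm_mul_le _ _) (norm_mul_le _ _)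
            (norm_nonneg _) (by positivity))
        · exact norm_mul_le _ _
    _ = ‖a + star g‖ * ‖a‖ ^ 3 + ‖a * g * a‖ * ‖a‖ := by
        rw [norm_star, norm_star]
        ring

lemma ConvexCurve.re_offset_pt_nonneg (γ : ConvexCurve) (θ φ : ℝ) :
    0 ≤ (γ.offset (γ.pt φ) θ).re := by
  obtain ⟨ψ, hψ, hφψ⟩ := γ.periodic_pt.exists_mem_Ico Real.two_pi_pos φ θ
  rw [hφψ]
  rcases hψ.1.eq_or_lt with rfl | hlt
  · simp [offset]
  · exact (γ.re_offset_pt_pos ⟨hlt, hψ.2⟩).le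

lemma ConvexCurve.homothety_mem_region {γ : ConvexCurve} {c z : ℂ} {t : ℝ} (hc : c ∈ γ.region)
    (hz : ∀ θ, 0 ≤ (γ.offset z θ).re) (ht : t ∈ Set.Ioo 0 1) :
    AffineMap.homothety c t z ∈ γ.region := fun θ => by
  have hoffset : γ.offset (AffineMap.homothety c t z) θ =
      t * γ.offset z θ + (1 - t : ℝ) * γ.offset c θ := by
    simp only [offset, AffineMap.homothety_apply, vsub_eq_sub, vadd_eq_add, real_smul]
    push_cast
    ring
  rw [hoffset, add_re, re_ofReal_mul, re_ofReal_mul]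
  exact add_pos_of_nonneg_of_pos (mul_nonneg ht.1.le (hz θ)) (mul_pos (sub_pos.2 ht.2) (hc θ))

section SchurClass

open Polynomial

/-- The holomorphic functions on `U` bounded by `1`. -/
def schurClass (U : Set ℂ) : Set (ℂ → ℂ) := {f | DifferentiableOn ℂ f U ∧ ∀ z ∈ U, ‖f z‖ ≤ 1}

variable {V : Type*} [NormedAddCommGroup V] [InnerProductSpace ℂ V] [CompleteSpace V]
  {γ : ConvexCurve} {T : V →L[ℂ] V} {S : Finset ℂ} {U : Set ℂ} {f : ℂ → ℂ} {K : ℝ}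

lemma norm_interpEval_pow_four_le (hT : aeval T (Lagrange.nodal S id) = 0)
    (hS : ∀ μ ∈ S, μ ∈ γ.region) (hγ : γ.Encloses T)
    (hK : ∀ g ∈ schurClass γ.region, ‖interpEval T S g‖ ≤ K) (hU : Convex ℝ U) (hUo : IsOpen U)
    (hin : γ.region ⊆ U) (hpt : ∀ θ, γ.pt θ ∈ U) (hf : f ∈ schurClass U) :
    ‖interpEval T S f‖ ^ 4 ≤ 2 * ‖interpEval T S f‖ ^ 3 + K * ‖interpEval T S f‖ := by
  set g := γ.cauchy fun θ => conj (f (γ.pt θ))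
  have hfc : Continuous fun θ => conj (f (γ.pt θ)) :=
    continuous_conj.comp (hf.1.continuousOn.comp_continuous γ.continuous_pt hpt)
  have hg1 : ∀ z ∈ γ.region, ‖g z‖ ≤ 1 := fun z hz =>
    ConvexCurve.norm_cauchy_conj_le hU hUo hf.1 hin hpt hf.2 hz
  have hfgf : ‖interpEval T S f * interpEval T S g * interpEval T S f‖ ≤ K := by
    rw [interpEval_mul hT, interpEval_mul hT]
    refine hK _ ⟨((hf.1.mono hin).mul (ConvexCurve.differentiableOn_cauchy hfc)).mul
      (hf.1.mono hin), fun z hz => ?_⟩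
    have hfz := hf.2 z (hin hz)
    rw [norm_mul, norm_mul]
    exact mul_le_one₀ (mul_le_one₀ hfz (norm_nonneg _) (hg1 z hz)) (norm_nonneg _) hfz
  refine (norm_pow_four_le _ (interpEval T S g)).trans ?_
  gcongr
  exact norm_interpEval_add_star_le hT hS hγ hU hUo hf.1 hin hpt hf.2

/-- Dilating towards `c` reduces to functions holomorphic in a neighbourhood of the closed
domain. -/
lemma norm_interpEval_pow_four_le_of_mem_schurClass (hT : aeval T (Lagrange.nodal S id) = 0)
    (hS : ∀ μ ∈ S, μ ∈ γ.region) (hγ : γ.Encloses T)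
    (hK : ∀ g ∈ schurClass γ.region, ‖interpEval T S g‖ ≤ K) {c : ℂ} (hc : c ∈ γ.region)
    (hf : f ∈ schurClass γ.region) :
    ‖interpEval T S f‖ ^ 4 ≤ 2 * ‖interpEval T S f‖ ^ 3 + K * ‖interpEval T S f‖ := by
  set F : ℝ → ℂ → ℂ := fun t => f ∘ AffineMap.homothety c t
  have hdiff (t : ℝ) : Differentiable ℂ (AffineMap.homothety c t) := by
    simp only [AffineMap.coe_homothety, vsub_eq_sub, vadd_eq_add]
    fun_prop
  have hdilated (t : ℝ) (ht : t ∈ Set.Ioo (0 : ℝ) 1) :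
      ‖interpEval T S (F t)‖ ^ 4 ≤
        2 * ‖interpEval T S (F t)‖ ^ 3 + K * ‖interpEval T S (F t)‖ :=
    norm_interpEval_pow_four_le hT hS hγ hK (U := AffineMap.homothety c t ⁻¹' γ.region)
      (γ.convex_region.affine_preimage _) (γ.isOpen_region.preimage (hdiff t).continuous)
      (fun z hz => ConvexCurve.homothety_mem_region hc (fun θ => (hz θ).le) ht)
      (fun θ => ConvexCurve.homothety_mem_region hc (fun φ => γ.re_offset_pt_nonneg φ θ) ht)
      ⟨hf.1.comp (hdiff t).differentiableOn fun z hz => hz, fun z hz => hf.2 _ hz⟩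
  have hlim : Tendsto (fun t => interpEval T S (F t)) (𝓝[<] 1) (𝓝 (interpEval T S f)) := by
    refine (tendsto_interpEval fun μ hμ => ?_).mono_left nhdsWithin_le_nhds
    have hcont : ContinuousAt (fun t : ℝ => AffineMap.homothety c t μ) 1 := by
      simp only [AffineMap.homothety_apply, vsub_eq_sub, vadd_eq_add]
      fun_prop
    have hfμ : ContinuousAt f (AffineMap.homothety c (1 : ℝ) μ) := by
      rw [AffineMap.homothety_one, AffineMap.id_apply]
      exact (hf.1.differentiableAt (γ.isOpen_region.mem_nhds (hS μ hμ))).continuousAt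
    have hlim := (ContinuousAt.comp (f := fun t : ℝ => AffineMap.homothety c t μ) hfμ hcont).tendsto
    rwa [Function.comp_apply, AffineMap.homothety_one, AffineMap.id_apply] at hlim
  refine le_of_tendsto_of_tendsto (hlim.norm.pow 4)
    (((hlim.norm.pow 3).const_mul 2).add (hlim.norm.const_mul K)) ?_
  filter_upwards [Ioo_mem_nhdsLT (zero_lt_one (α := ℝ))] with t ht using hdilated t ht

lemma le_one_add_sqrt_two {K : ℝ} (hK : K ^ 3 ≤ 2 * K ^ 2 + K) : K ≤ 1 + √2 := by
  by_contra! hlt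
  have hsqrt := Real.sqrt_nonneg 2
  have hquad : K ^ 2 ≤ 2 * K + 1 :=
    le_of_mul_le_mul_right (by linarith) (show 0 < K by linarith)
  nlinarith [Real.sq_sqrt zero_le_two]

/-- The **Crouzeix–Palencia theorem** for an operator with simple spectrum. -/
theorem norm_interpEval_le (hT : aeval T (Lagrange.nodal S id) = 0)
    (hS : ∀ μ ∈ S, μ ∈ γ.region) (hγ : γ.Encloses T) (hf : f ∈ schurClass γ.region) :
    ‖interpEval T S f‖ ≤ 1 + √2 := by
  rcases S.eq_empty_or_nonempty with rfl | ⟨c, hcS⟩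
  · rw [interpEval_eq_sum, Finset.sum_empty, norm_zero]
    positivity
  set norms := (fun g => ‖interpEval T S g‖) '' schurClass γ.region
  have hbdd : BddAbove norms := ⟨∑ μ ∈ S, ‖aeval T (Lagrange.basis S id μ)‖, by
    rintro _ ⟨g, hg, rfl⟩
    exact norm_interpEval_le_sum fun μ hμ => hg.2 μ (hS μ hμ)⟩
  have hle : ∀ g ∈ schurClass γ.region, ‖interpEval T S g‖ ≤ sSup norms := fun g hg =>
    le_csSup hbdd ⟨g, hg, rfl⟩
  have hcubic : ∀ x ∈ norms, x ^ 3 ≤ 2 * x ^ 2 + sSup norms := by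
    rintro _ ⟨g, hg, rfl⟩
    have hquartic := norm_interpEval_pow_four_le_of_mem_schurClass hT hS hγ hle (hS c hcS) hg
    rcases (norm_nonneg (interpEval T S g)).eq_or_lt with hzero | hpos
    · simpa [← hzero] using hle g hg
    · exact le_of_mul_le_mul_right (by linarith) hpos
  obtain ⟨u, -, hu, hunorms⟩ := exists_seq_tendsto_sSup (Set.image_nonempty.2 ⟨f, hf⟩) hbdd
  exact (hle f hf).trans <| le_one_add_sqrt_two <|
    le_of_tendsto_of_tendsto (hu.pow 3) (((hu.pow 2).const_mul 2).add_const _)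
      (Eventually.of_forall fun n => hcubic _ (hunorms n))

end SchurClass

/-! ### Approximation of a convex set by domains bounded by convex curves -/

/-- The support function of a planar set, as a function of the angle of the outer normal. -/
def supportFun (K : Set ℂ) (θ : ℝ) : ℝ := sSup ((fun z => (cexp (-(θ * I)) * z).re) '' K)

section SupportFun

variable {K : Set ℂ} {z : ℂ} {ε : ℝ}

lemma re_le_supportFun (hK : IsCompact K) (hz : z ∈ K) (θ : ℝ) :
    (cexp (-(θ * I)) * z).re ≤ supportFun K θ :=
  le_csSup (hK.bddAbove_image (by fun_prop)) ⟨z, hz, rfl⟩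

lemma exists_re_eq_supportFun (hK : IsCompact K) (hne : K.Nonempty) (θ : ℝ) :
    ∃ z ∈ K, (cexp (-(θ * I)) * z).re = supportFun K θ :=
  (hK.image (f := fun z : ℂ => (cexp (-(θ * I)) * z).re) (by fun_prop)).sSup_mem (hne.image _)

lemma exists_lipschitzWith_supportFun (hK : IsCompact K) (hne : K.Nonempty) :
    ∃ R, LipschitzWith R (supportFun K) := by
  obtain ⟨R, hR⟩ := hK.isBounded.exists_norm_le
  refine ⟨R.toNNReal, LipschitzWith.of_le_add_mul' R fun θ φ => ?_⟩
  obtain ⟨z, hz, hθ⟩ := exists_re_eq_supportFun hK hne θ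
  have hexp : cexp (-(θ * I)) * z - cexp (-(φ * I)) * z =
      cexp (-(φ * I)) * (z * (cexp (I * (φ - θ : ℝ)) - 1)) := by
    rw [mul_sub, mul_sub, mul_left_comm, ← Complex.exp_add]
    push_cast
    ring_nf
  have hdist : (cexp (-(θ * I)) * z - cexp (-(φ * I)) * z).re ≤ R * dist θ φ := by
    refine (re_le_norm _).trans ?_
    rw [hexp, norm_mul, norm_exp_neg_mul_I, one_mul, norm_mul, dist_comm, dist_eq_norm]
    exact mul_le_mul (hR z hz) Real.norm_exp_I_mul_ofReal_sub_one_le (norm_nonneg _)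
      ((norm_nonneg z).trans (hR z hz))
  rw [sub_re, hθ] at hdist
  linarith [re_le_supportFun hK hz φ]

lemma periodic_supportFun (K : Set ℂ) : Function.Periodic (supportFun K) (2 * π) := fun θ => by
  have h : cexp (-((θ + 2 * π : ℝ) * I)) = cexp (-(θ * I)) := periodic_exp_neg_mul_I θ
  simp only [supportFun, h]

lemma two_cos_mul_supportFun_le (hK : IsCompact K) (hne : K.Nonempty) (θ δ : ℝ) :
    2 * Real.cos δ * supportFun K θ ≤ supportFun K (θ - δ) + supportFun K (θ + δ) := by
  obtain ⟨z, hz, hθ⟩ := exists_re_eq_supportFun hK hne θ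
  have hsum : cexp (-((θ - δ : ℝ) * I)) * z + cexp (-((θ + δ : ℝ) * I)) * z =
      (2 * Real.cos δ : ℝ) * (cexp (-(θ * I)) * z) := by
    have hsub : -(((θ - δ : ℝ) : ℂ) * I) = -(θ * I) + δ * I := by push_cast; ring
    have hadd : -(((θ + δ : ℝ) : ℂ) * I) = -(θ * I) + -δ * I := by push_cast; ring
    rw [hsub, hadd, Complex.exp_add, Complex.exp_add, ofReal_mul, ofReal_ofNat, ofReal_cos,
      Complex.two_cos]
    ring
  have hre := congrArg re hsum
  rw [add_re, re_ofReal_mul, hθ] at hre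
  linarith [re_le_supportFun hK hz (θ - δ), re_le_supportFun hK hz (θ + δ)]

lemma norm_mul_exp_neg_arg_mul_I (z : ℂ) : ‖z‖ * cexp (-(z.arg * I)) = conj z := by
  have h := congrArg conj (norm_mul_exp_arg_mul_I z)
  rwa [map_mul, conj_ofReal, ← exp_conj, map_mul, conj_ofReal, conj_I, mul_neg] at h

lemma mem_cthickening_of_re_le_supportFun_add (hK : IsCompact K) (hconv : Convex ℝ K)
    (hne : K.Nonempty) (hε : 0 ≤ ε)
    (h : ∀ θ : ℝ, (cexp (-(θ * I)) * z).re ≤ supportFun K θ + ε) :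
    z ∈ Metric.cthickening ε K := by
  obtain ⟨k, hk, hdist⟩ := hK.exists_infDist_eq_dist hne z
  refine Metric.mem_cthickening_of_dist_le z k ε K hk ?_
  rw [dist_eq_norm]
  set u := z - k with hu
  rcases eq_or_ne u 0 with hzero | hzero
  · rwa [hzero, norm_zero]
  obtain ⟨k', hk', hsupp⟩ := exists_re_eq_supportFun hK hne u.arg
  have hproj : (conj u * (k' - k)).re ≤ 0 := by
    rw [mul_comm, ← Complex.inner]
    refine (norm_eq_iInf_iff_real_inner_le_zero hconv hk).1 ?_ k' hk'
    simp only [← dist_eq_norm, ← hdist, Metric.infDist_eq_iInf]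
  have hsep : (conj u * z).re ≤ (conj u * k').re + ‖u‖ * ε := by
    have hscaled := mul_le_mul_of_nonneg_left (h u.arg) (norm_nonneg u)
    rwa [← hsupp, mul_add, ← re_ofReal_mul, ← re_ofReal_mul, ← mul_assoc, ← mul_assoc,
      norm_mul_exp_neg_arg_mul_I] at hscaled
  have hnorm : (conj u * u).re = ‖u‖ * ‖u‖ := by
    rw [← normSq_eq_conj_mul_self, ofReal_re, normSq_eq_norm_sq, sq]
  refine le_of_mul_le_mul_left ?_ (norm_pos_iff.2 hzero)
  rw [← hnorm, hu, mul_sub, sub_re, ← hu]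
  rw [mul_sub, sub_re] at hproj
  linarith

end SupportFun

/-- The curve obtained by smoothing the boundary of a convex set with the support function `h`, up
to a factor: its radius of curvature at the parameter `θ` is the second difference
`h (θ - δ) + h (θ + δ) - 2 cos δ h θ`, in place of `h + h''`. -/
def smoothedCurve (h : ℝ → ℝ) (δ θ : ℝ) : ℂ :=
  I * cexp (θ * I) * ∫ w in 0..δ,
    (h (θ + w) * cexp (-((δ - w) * I)) - h (θ - w) * cexp ((δ - w) * I))

section SmoothedCurve

variable {h : ℝ → ℝ} (δ : ℝ)

lemma periodic_smoothedCurve (hper : Function.Periodic h (2 * π)) :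
    Function.Periodic (smoothedCurve h δ) (2 * π) := fun θ => by
  have hexp : cexp ((θ + 2 * π : ℝ) * I) = cexp (θ * I) := by
    rw [ofReal_add, add_mul, ofReal_mul, ofReal_ofNat, Complex.exp_periodic (θ * I)]
  simp only [smoothedCurve, hexp, add_right_comm θ (2 * π), add_sub_right_comm θ (2 * π), hper _]

lemma smoothedCurve_eq_primitive (hh : Continuous h) {G : ℝ → ℂ}
    (hG : ∀ θ, HasDerivAt G (h θ * cexp (θ * I)) θ) (θ : ℝ) :
    smoothedCurve h δ θ =
      I * (cexp (-(δ * I)) * (G (θ + δ) - G θ) - cexp (δ * I) * (G θ - G (θ - δ))) := by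
  have hadd : G (θ + δ) - G θ = ∫ w in 0..δ, h (θ + w) * cexp ((θ + w : ℝ) * I) := by
    rw [integral_comp_add_left (fun u : ℝ => (h u * cexp (u * I) : ℂ)) θ, add_zero,
      integral_eq_sub_of_hasDerivAt (fun u _ => hG u)
        (Continuous.intervalIntegrable (by fun_prop) _ _)]
  have hsub : G θ - G (θ - δ) = ∫ w in 0..δ, h (θ - w) * cexp ((θ - w : ℝ) * I) := by
    rw [integral_comp_sub_left (fun u : ℝ => (h u * cexp (u * I) : ℂ)) θ, sub_zero,
      integral_eq_sub_of_hasDerivAt (fun u _ => hG u)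
        (Continuous.intervalIntegrable (by fun_prop) _ _)]
  rw [hadd, hsub, smoothedCurve, mul_assoc, ← intervalIntegral.integral_const_mul,
    ← intervalIntegral.integral_const_mul (cexp (-(δ * I))),
    ← intervalIntegral.integral_const_mul (cexp (δ * I)),
    ← intervalIntegral.integral_sub (Continuous.intervalIntegrable (by fun_prop) _ _)
      (Continuous.intervalIntegrable (by fun_prop) _ _)]
  refine congrArg (I * ·) (integral_congr fun w _ => ?_)
  simp only [mul_sub, mul_left_comm _ (ofReal _), ← Complex.exp_add]
  push_cast
  ring_nf

lemma hasDerivAt_smoothedCurve (hh : Continuous h) (θ : ℝ) :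
    HasDerivAt (smoothedCurve h δ)
      (I * cexp (θ * I) * ((h (θ - δ) + h (θ + δ) - 2 * Real.cos δ * h θ : ℝ) : ℂ)) θ := by
  set G : ℝ → ℂ := fun θ => ∫ u in 0..θ, h u * cexp (u * I)
  have hG (θ : ℝ) : HasDerivAt G (h θ * cexp (θ * I)) θ :=
    (Continuous.integral_hasStrictDerivAt (by fun_prop) 0 θ).hasDerivAt
  rw [funext (smoothedCurve_eq_primitive δ hh hG)]
  refine ((((((hG (θ + δ)).comp_add_const θ δ).sub (hG θ)).const_mul (cexp (-(δ * I)))).sub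
    (((hG θ).sub ((hG (θ - δ)).comp_sub_const θ δ)).const_mul (cexp (δ * I)))).const_mul
    I).congr_deriv ?_
  rw [ofReal_add, ofReal_sub, add_mul, sub_mul, sub_eq_add_neg (θ * I : ℂ), Complex.exp_add,
    Complex.exp_add]
  push_cast
  rw [Complex.two_cos, neg_mul]
  linear_combination I * cexp (θ * I) * (h (θ - δ) + h (θ + δ)) * exp_neg_mul_I_mul_exp δ

lemma re_exp_neg_mul_smoothedCurve (hh : Continuous h) (θ : ℝ) :
    (cexp (-(θ * I)) * smoothedCurve h δ θ).re =
      ∫ w in 0..δ, (h (θ - w) + h (θ + w)) * Real.sin (δ - w) := by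
  have hcancel : cexp (-(θ * I)) * smoothedCurve h δ θ = ∫ w in 0..δ,
      I * (h (θ + w) * cexp (-((δ - w) * I)) - h (θ - w) * cexp ((δ - w) * I)) := by
    rw [smoothedCurve, intervalIntegral.integral_const_mul]
    linear_combination I * (∫ w in 0..δ, (h (θ + w) * cexp (-((δ - w) * I)) -
      h (θ - w) * cexp ((δ - w) * I))) * exp_neg_mul_I_mul_exp θ
  rw [hcancel, ← reCLM_apply, ← reCLM.intervalIntegral_comp_comm
    (Continuous.intervalIntegrable (by fun_prop) _ _)]
  refine integral_congr fun w _ => ?_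
  have hexp : cexp (-((δ - w) * I)) = cexp ((-(δ - w) : ℝ) * I) := by push_cast; ring_nf
  have hexp' : cexp ((δ - w) * I) = cexp ((δ - w : ℝ) * I) := by push_cast; rfl
  simp only [reCLM_apply, hexp, hexp', I_mul_re, sub_im, im_ofReal_mul, exp_ofReal_mul_I_im,
    Real.sin_neg]
  ring

lemma abs_re_smoothedCurve_sub_le {δ θ η : ℝ} (hh : Continuous h) (hδ : 0 ≤ δ) (hδpi : δ ≤ π)
    (hη : ∀ u, |u - θ| ≤ δ → |h u - h θ| ≤ η) :
    |(cexp (-(θ * I)) * smoothedCurve h δ θ).re - 2 * (1 - Real.cos δ) * h θ| ≤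
      2 * (1 - Real.cos δ) * η := by
  have hsin : ∫ w in 0..δ, Real.sin (δ - w) = 1 - Real.cos δ := by
    rw [integral_comp_sub_left Real.sin, sub_zero, sub_self, integral_sin, Real.cos_zero]
  have hconst (c : ℝ) : 2 * (1 - Real.cos δ) * c = ∫ w in 0..δ, 2 * c * Real.sin (δ - w) := by
    rw [intervalIntegral.integral_const_mul, hsin]
    ring
  rw [re_exp_neg_mul_smoothedCurve δ hh, hconst, hconst, ← intervalIntegral.integral_sub
    (Continuous.intervalIntegrable (by fun_prop) _ _)
    (Continuous.intervalIntegrable (by fun_prop) _ _), ← Real.norm_eq_abs]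
  refine norm_integral_le_of_norm_le hδ (Eventually.of_forall fun w hw => ?_)
    (Continuous.intervalIntegrable (by fun_prop) _ _)
  have hpos : 0 ≤ Real.sin (δ - w) :=
    Real.sin_nonneg_of_nonneg_of_le_pi (by linarith [hw.2]) (by linarith [hw.1])
  have hsub : |h (θ - w) - h θ| ≤ η :=
    hη _ (by rw [sub_sub_cancel_left, abs_neg, abs_of_pos hw.1]; exact hw.2)
  have hadd : |h (θ + w) - h θ| ≤ η :=
    hη _ (by rw [add_sub_cancel_left, abs_of_pos hw.1]; exact hw.2)
  rw [← sub_mul, norm_mul, Real.norm_of_nonneg hpos, Real.norm_eq_abs]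
  gcongr
  calc |h (θ - w) + h (θ + w) - 2 * h θ| = |(h (θ - w) - h θ) + (h (θ + w) - h θ)| := by ring_nf
    _ ≤ 2 * η := by linarith [abs_add_le (h (θ - w) - h θ) (h (θ + w) - h θ)]

lemma exists_convexCurve_abs_re_offset_sub_le (hunif : UniformContinuous h)
    (hper : Function.Periodic h (2 * π))
    (hpos : ∀ θ δ, 0 < δ → δ ≤ π → 2 * Real.cos δ * h θ < h (θ - δ) + h (θ + δ)) {η : ℝ}
    (hη : 0 < η) : ∃ γ : ConvexCurve, ∀ z θ,
      |(γ.offset z θ).re - (h θ - (cexp (-(θ * I)) * z).re)| ≤ η := by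
  have hh := hunif.continuous
  obtain ⟨d, hd, hdist⟩ := Metric.uniformContinuous_iff.1 hunif η hη
  obtain ⟨δ, hδ, hδlt⟩ := exists_between (lt_min hd Real.pi_pos)
  obtain ⟨hδd, hδpi⟩ := lt_min_iff.1 hδlt
  set c := 2 * (1 - Real.cos δ)
  have hcpos : 0 < c := by
    have := Real.cos_lt_cos_of_nonneg_of_le_pi le_rfl hδpi.le hδ
    rw [Real.cos_zero] at this
    linarith
  let γ : ConvexCurve :=
    { pt := fun θ => smoothedCurve h δ θ / c
      speed := fun θ => (h (θ - δ) + h (θ + δ) - 2 * Real.cos δ * h θ) / c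
      speed_pos := fun θ => div_pos (sub_pos.2 (hpos θ δ hδ hδpi.le)) hcpos
      continuous_speed := by fun_prop
      periodic_speed := fun θ => by
        simp only [add_right_comm θ (2 * π), add_sub_right_comm θ (2 * π), hper _]
      periodic_pt := fun θ => by simp only [periodic_smoothedCurve δ hper θ]
      hasDerivAt_pt := fun θ => ((hasDerivAt_smoothedCurve δ hh θ).div_const (c : ℂ)).congr_deriv
        (by push_cast; ring) }
  refine ⟨γ, fun z θ => ?_⟩
  have hclose := abs_re_smoothedCurve_sub_le (θ := θ) hh hδ.le hδpi.le fun u hu =>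
    (hdist (hu.trans_lt hδd)).le
  have hoffset : (γ.offset z θ).re - (h θ - (cexp (-(θ * I)) * z).re) =
      ((cexp (-(θ * I)) * smoothedCurve h δ θ).re - c * h θ) / c := by
    simp only [ConvexCurve.offset, γ]
    rw [mul_sub, sub_re, mul_div_assoc', div_ofReal_re]
    field_simp
    ring
  rwa [hoffset, abs_div, abs_of_pos hcpos, div_le_iff₀ hcpos, mul_comm η]

end SmoothedCurve

theorem exists_convexCurve {K : Set ℂ} {ε : ℝ} (hK : IsCompact K) (hconv : Convex ℝ K)
    (hne : K.Nonempty) (hε : 0 < ε) :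
    ∃ γ : ConvexCurve, K ⊆ γ.region ∧ γ.region ⊆ Metric.cthickening ε K := by
  obtain ⟨R, hlip⟩ := exists_lipschitzWith_supportFun hK hne
  obtain ⟨γ, hγ⟩ := exists_convexCurve_abs_re_offset_sub_le (h := fun θ => supportFun K θ + ε / 2)
    (hlip.uniformContinuous.add uniformContinuous_const)
    (fun θ => by simp only [periodic_supportFun K θ])
    (fun θ δ hδ hδpi => by
      have hcos := Real.cos_lt_cos_of_nonneg_of_le_pi le_rfl hδpi hδ
      rw [Real.cos_zero] at hcos
      nlinarith [two_cos_mul_supportFun_le hK hne θ δ])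
    (η := ε / 4) (by positivity)
  refine ⟨γ, fun z hz θ => ?_, fun z hz => ?_⟩
  · linarith [(abs_le.1 (hγ z θ)).1, re_le_supportFun hK hz θ]
  · refine mem_cthickening_of_re_le_supportFun_add hK hconv hne hε.le fun θ => ?_
    linarith [(abs_le.1 (hγ z θ)).2, hz θ]

/-! ### The Crouzeix–Palencia theorem for matrices -/

open Polynomial Matrix
open scoped Matrix.Norms.L2Operator

section Separable

variable {ι : Type*} [Fintype ι] [DecidableEq ι]

lemma exists_forall_separable_map_iff {R : Type*} [CommRing R] {P : R[X]} (hP : P.Monic)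
    (K : Type*) [Field K] [CharZero K] :
    ∃ r : R, ∀ φ : R →+* K, (P.map φ).Separable ↔ φ r ≠ 0 := by
  refine ⟨resultant P (derivative P) P.natDegree (P.natDegree - 1), fun φ => ?_⟩
  have hdeg := hP.natDegree_map φ
  rw [separable_def, ← isUnit_resultant_iff_isCoprime (hP.map φ), isUnit_iff_ne_zero,
    natDegree_derivative, hdeg, derivative_map, resultant_map_map]

lemma separable_charpoly_diagonal {K : Type*} [Field K] {d : ι → K} (hd : Function.Injective d) :
    (diagonal d).charpoly.Separable := by
  rw [charpoly_diagonal]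
  exact separable_prod_X_sub_C_iff.2 hd

lemma eventually_eval_ne_zero {r : ℂ[X]} (hr : r ≠ 0) (c : ℂ) : ∀ᶠ t in 𝓝[≠] c, r.eval t ≠ 0 :=
  nhdsNE_le_cofinite c (finite_setOfPred_isRoot hr).compl_mem_cofinite

/-- The discriminant of the characteristic polynomial is a nonzero polynomial along the line from
a matrix to a diagonal matrix with distinct entries. -/
lemma dense_setOf_separable_charpoly :
    Dense {A : Matrix ι ι ℂ | A.charpoly.Separable} := fun A => by
  set D : Matrix ι ι ℂ := diagonal fun i => ((Fintype.equivFin ι i : ℕ) : ℂ)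
  have hD : D.charpoly.Separable := separable_charpoly_diagonal fun i j hij =>
    (Fintype.equivFin ι).injective (Fin.ext (Nat.cast_injective hij))
  set line : Matrix ι ι ℂ[X] := A.map C + (X : ℂ[X]) • (D - A).map C
  have hline (t : ℂ) : line.charpoly.map (evalRingHom t) = (A + t • (D - A)).charpoly := by
    rw [← charpoly_map]
    congr 1
    ext i j
    simp [line]
  obtain ⟨r, hr⟩ := exists_forall_separable_map_iff line.charpoly_monic ℂ
  have hr_ne : r ≠ 0 := by
    rintro rfl
    refine (hr (evalRingHom 1)).1 ?_ (map_zero _)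
    rwa [hline, one_smul, add_sub_cancel]
  have hlim : Tendsto (fun t : ℂ => A + t • (D - A)) (𝓝[≠] 0) (𝓝 A) := by
    refine Tendsto.mono_left ?_ nhdsWithin_le_nhds
    exact (Continuous.tendsto (by fun_prop) 0).trans_eq (by rw [zero_smul, add_zero])
  refine mem_closure_of_tendsto hlim ((eventually_eval_ne_zero hr_ne 0).mono fun t ht => ?_)
  rw [Set.mem_ofPred_eq, ← hline]
  exact (hr (evalRingHom t)).2 ht

lemma nodal_toFinset_roots {P : ℂ[X]} (hP : P.Monic) (hsep : P.Separable) :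
    Lagrange.nodal P.roots.toFinset id = P := by
  conv_rhs => rw [(IsAlgClosed.splits P).eq_prod_roots_of_monic hP]
  rw [Lagrange.nodal_eq, Finset.prod_eq_multiset_prod, Multiset.toFinset_val,
    (nodup_roots hsep).dedup]
  rfl

end Separable

section NumericalRange

variable {ι : Type*} [Fintype ι]

lemma numericalRange_nonempty [Nonempty ι] (A : Matrix ι ι ℂ) : (numericalRange A).Nonempty := by
  obtain ⟨x, hx⟩ := exists_norm_eq (EuclideanSpace ℂ ι) (zero_le_one (α := ℝ))
  exact ⟨_, x, hx, rfl⟩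

variable [DecidableEq ι]

lemma aeval_toEuclideanCLM (A : Matrix ι ι ℂ) (p : ℂ[X]) :
    aeval (toEuclideanCLM (𝕜 := ℂ) A) p = toEuclideanCLM (𝕜 := ℂ) (aeval A p) :=
  aeval_algHom_apply (toEuclideanCLM (n := ι) (𝕜 := ℂ)).toStarAlgHom.toAlgHom A p

lemma inner_toEuclideanCLM_eq (A : Matrix ι ι ℂ) (x : EuclideanSpace ℂ ι) :
    inner ℂ x (toEuclideanCLM (𝕜 := ℂ) A x) = star x.ofLp ⬝ᵥ (A *ᵥ x.ofLp) := by
  rw [EuclideanSpace.inner_eq_star_dotProduct, ofLp_toEuclideanCLM, dotProduct_comm]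

lemma inner_mem_numericalRange (A : Matrix ι ι ℂ) {x : EuclideanSpace ℂ ι} (hx : ‖x‖ = 1) :
    inner ℂ x (toEuclideanCLM (𝕜 := ℂ) A x) ∈ numericalRange A :=
  ⟨x, hx, inner_toEuclideanCLM_eq A x⟩

lemma exists_inner_eq_of_mem_numericalRange {A : Matrix ι ι ℂ} {z : ℂ}
    (hz : z ∈ numericalRange A) :
    ∃ x : EuclideanSpace ℂ ι, ‖x‖ = 1 ∧ inner ℂ x (toEuclideanCLM (𝕜 := ℂ) A x) = z := by
  obtain ⟨x, hx, rfl⟩ := hz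
  exact ⟨x, hx, inner_toEuclideanCLM_eq A x⟩

lemma mem_numericalRange_of_isRoot_charpoly {A : Matrix ι ι ℂ} {μ : ℂ}
    (hμ : A.charpoly.IsRoot μ) : μ ∈ numericalRange A := by
  rw [IsRoot, eval_charpoly] at hμ
  obtain ⟨v, hv, hAv⟩ := exists_mulVec_eq_zero_iff.2 hμ
  set x : EuclideanSpace ℂ ι := WithLp.toLp 2 v
  have hx : x ≠ 0 := fun h => hv (congrArg WithLp.ofLp h)
  have hAx : toEuclideanCLM (𝕜 := ℂ) A x = μ • x := by
    rw [sub_mulVec, scalar_apply, ← smul_one_eq_diagonal, smul_mulVec, one_mulVec,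
      sub_eq_zero] at hAv
    rw [toEuclideanCLM_toLp, ← hAv, WithLp.toLp_smul]
  have hu := norm_smul_inv_norm (𝕜 := ℂ) hx
  have hmem := inner_mem_numericalRange A hu
  rwa [map_smul, hAx, smul_comm, inner_smul_right, inner_self_eq_norm_sq_to_K, hu,
    RCLike.ofReal_one, one_pow, mul_one] at hmem

omit [DecidableEq ι] in
lemma isBounded_numericalRange (A : Matrix ι ι ℂ) : Bornology.IsBounded (numericalRange A) := by
  classical
  refine (Metric.isBounded_closedBall (x := (0 : ℂ)) (r := ‖A‖)).subset fun z hz => ?_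
  obtain ⟨x, hx, rfl⟩ := exists_inner_eq_of_mem_numericalRange hz
  rw [mem_closedBall_zero_iff]
  calc ‖inner ℂ x (toEuclideanCLM (𝕜 := ℂ) A x)‖
    _ ≤ ‖x‖ * (‖A‖ * ‖x‖) := (norm_inner_le_norm _ _).trans
      (mul_le_mul_of_nonneg_left ((toEuclideanCLM (𝕜 := ℂ) A).le_opNorm x) (norm_nonneg x))
    _ = ‖A‖ := by rw [hx, one_mul, mul_one]

omit [DecidableEq ι] in
lemma eventually_numericalRange_subset {A : Matrix ι ι ℂ} {U : Set ℂ} (hU : IsOpen U)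
    (hA : closure (numericalRange A) ⊆ U) : ∀ᶠ B in 𝓝 A, numericalRange B ⊆ U := by
  classical
  obtain ⟨δ, hδ, hthick⟩ :=
    (isBounded_numericalRange A).isCompact_closure.exists_thickening_subset_open hU hA
  filter_upwards [Metric.ball_mem_nhds A hδ] with B hB z hz
  obtain ⟨x, hx, rfl⟩ := exists_inner_eq_of_mem_numericalRange hz
  refine hthick (Metric.mem_thickening_iff.2
    ⟨_, subset_closure (inner_mem_numericalRange A hx), ?_⟩)
  calc dist (inner ℂ x (toEuclideanCLM (𝕜 := ℂ) B x)) (inner ℂ x (toEuclideanCLM (𝕜 := ℂ) A x))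
    _ = ‖inner ℂ x (toEuclideanCLM (𝕜 := ℂ) (B - A) x)‖ := by
      rw [dist_eq_norm, ← inner_sub_right, map_sub, _root_.sub_apply]
    _ ≤ ‖x‖ * (‖B - A‖ * ‖x‖) := (norm_inner_le_norm _ _).trans
      (mul_le_mul_of_nonneg_left ((toEuclideanCLM (𝕜 := ℂ) _).le_opNorm x) (norm_nonneg x))
    _ < δ := by rwa [hx, one_mul, mul_one, ← dist_eq_norm]

end NumericalRange

section Operator

variable {V : Type*} [NormedAddCommGroup V] [InnerProductSpace ℂ V] {T : V →L[ℂ] V}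
  {γ : ConvexCurve}

lemma encloses_of_forall_inner_mem_region
    (h : ∀ x, ‖x‖ = 1 → inner ℂ x (T x) ∈ γ.region) : γ.Encloses T := fun θ x => by
  rcases eq_or_ne x 0 with rfl | hx
  · simp
  set u : V := (‖x‖⁻¹ : ℂ) • x
  have hu : ‖u‖ = 1 := norm_smul_inv_norm hx
  have hxu : x = (‖x‖ : ℂ) • u := by
    rw [smul_inv_smul₀ (ofReal_ne_zero.2 (norm_ne_zero_iff.2 hx))]
  have hoffset : inner ℂ u (cexp (-(θ * I)) • (γ.pt θ • u - T u)) =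
      γ.offset (inner ℂ u (T u)) θ := by
    rw [inner_smul_right, inner_sub_right, inner_smul_right, inner_self_eq_norm_sq_to_K, hu,
      RCLike.ofReal_one, one_pow, mul_one, ConvexCurve.offset]
  rw [hxu, map_smul, smul_comm (γ.pt θ), ← smul_sub, smul_comm (cexp _), inner_smul_left,
    inner_smul_right, hoffset, conj_ofReal, ← mul_assoc, ← ofReal_mul, re_ofReal_mul]
  exact mul_nonneg (mul_self_nonneg _) (h u hu θ).le

variable [CompleteSpace V] {S : Finset ℂ} {p q : ℂ[X]} {c : ℝ}

lemma norm_aeval_apply_le_of_encloses (hT : aeval T (Lagrange.nodal S id) = 0)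
    (hS : ∀ μ ∈ S, μ ∈ γ.region) (hγ : γ.Encloses T) (hc : 0 < c)
    (hpq : ∀ z ∈ γ.region, ‖p.eval z‖ < c * ‖q.eval z‖) (x : V) :
    ‖aeval T p x‖ ≤ (1 + √2) * c * ‖aeval T q x‖ := by
  have hq (z : ℂ) (hz : z ∈ γ.region) : c * q.eval z ≠ 0 :=
    mul_ne_zero (ofReal_ne_zero.2 hc.ne') fun h =>
      (norm_nonneg _).not_gt ((hpq z hz).trans_eq (by rw [h, norm_zero, mul_zero]))
  set f : ℂ → ℂ := fun z => p.eval z / (c * q.eval z)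
  have hf : f ∈ schurClass γ.region := by
    refine ⟨p.differentiable.differentiableOn.div
      (q.differentiable.const_mul _).differentiableOn hq, fun z hz => ?_⟩
    rw [norm_div, norm_mul, norm_real, Real.norm_of_nonneg hc.le]
    exact div_le_one_of_le₀ (hpq z hz).le (by positivity)
  have hfactor : aeval T p = interpEval T S f * ((c : ℂ) • aeval T q) := by
    have hcq : (c : ℂ) • aeval T q = interpEval T S fun z => (C (c : ℂ) * q).eval z := by
      rw [interpEval_eval hT, map_mul, aeval_C, Algebra.smul_def]
    rw [hcq, interpEval_mul hT, ← interpEval_eval hT]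
    refine interpEval_congr fun μ hμ => ?_
    rw [eval_mul, eval_C, div_mul_cancel₀ _ (hq μ (hS μ hμ))]
  calc ‖aeval T p x‖ = ‖interpEval T S f ((c : ℂ) • aeval T q x)‖ := by rw [hfactor]; rfl
    _ ≤ (1 + √2) * ‖(c : ℂ) • aeval T q x‖ :=
      (interpEval T S f).le_of_opNorm_le (norm_interpEval_le hT hS hγ hf) _
    _ = (1 + √2) * c * ‖aeval T q x‖ := by
      rw [norm_smul, norm_real, Real.norm_of_nonneg hc.le, mul_assoc]

end Operator

section CrouzeixPalencia

variable {ι : Type*} [Fintype ι] [DecidableEq ι] {A : Matrix ι ι ℂ} {γ : ConvexCurve}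
  {p q : ℂ[X]} {c : ℝ}

lemma norm_aeval_le_of_separable (hA : A.charpoly.Separable) (hW : numericalRange A ⊆ γ.region)
    (hc : 0 < c) (hpq : ∀ z ∈ γ.region, ‖p.eval z‖ < c * ‖q.eval z‖) (x : EuclideanSpace ℂ ι) :
    ‖toEuclideanCLM (𝕜 := ℂ) (aeval A p) x‖ ≤
      (1 + √2) * c * ‖toEuclideanCLM (𝕜 := ℂ) (aeval A q) x‖ := by
  rw [← aeval_toEuclideanCLM, ← aeval_toEuclideanCLM]
  refine norm_aeval_apply_le_of_encloses (S := A.charpoly.roots.toFinset) ?_ (fun μ hμ => hW ?_)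
    (encloses_of_forall_inner_mem_region fun y hy => hW (inner_mem_numericalRange A hy)) hc hpq x
  · rw [nodal_toFinset_roots A.charpoly_monic hA, aeval_toEuclideanCLM, aeval_self_charpoly,
      map_zero]
  · exact mem_numericalRange_of_isRoot_charpoly (isRoot_of_mem_roots (Multiset.mem_toFinset.1 hμ))

lemma norm_aeval_le_of_closure_subset_region (hW : closure (numericalRange A) ⊆ γ.region)
    (hc : 0 < c) (hpq : ∀ z ∈ γ.region, ‖p.eval z‖ < c * ‖q.eval z‖) (x : EuclideanSpace ℂ ι) :
    ‖toEuclideanCLM (𝕜 := ℂ) (aeval A p) x‖ ≤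
      (1 + √2) * c * ‖toEuclideanCLM (𝕜 := ℂ) (aeval A q) x‖ := by
  have hlim (r : ℂ[X]) : Tendsto (fun B : Matrix ι ι ℂ => ‖toEuclideanCLM (𝕜 := ℂ) (aeval B r) x‖)
      (𝓝 A) (𝓝 ‖toEuclideanCLM (𝕜 := ℂ) (aeval A r) x‖) := by
    have hL : Continuous (toEuclideanCLM (n := ι) (𝕜 := ℂ)) :=
      AddMonoidHomClass.continuous_of_bound _ 1 fun B => (one_mul ‖B‖).ge
    exact ((hL.comp (Polynomial.continuous_aeval r)).clm_apply continuous_const).norm.tendsto A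
  refine le_of_tendsto_of_tendsto_of_frequently (hlim p) ((hlim q).const_mul _) ?_
  refine ((mem_closure_iff_frequently.1 (dense_setOf_separable_charpoly A)).and_eventually
    (eventually_numericalRange_subset γ.isOpen_region hW)).mono fun B hB => ?_
  exact norm_aeval_le_of_separable hB.1 hB.2 hc hpq x

/-- The **Crouzeix–Palencia theorem** for a rational function `p / q`. -/
theorem norm_aeval_le_of_numericalRange (hcop : IsCoprime p q) (hc : 0 ≤ c)
    (hpq : ∀ z ∈ convexHull ℝ (numericalRange A), ‖p.eval z‖ ≤ c * ‖q.eval z‖)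
    (x : EuclideanSpace ℂ ι) :
    ‖toEuclideanCLM (𝕜 := ℂ) (aeval A p) x‖ ≤
      (1 + √2) * c * ‖toEuclideanCLM (𝕜 := ℂ) (aeval A q) x‖ := by
  rcases isEmpty_or_nonempty ι with hι | hι
  · simp [Subsingleton.elim x 0]
  set K := closure (convexHull ℝ (numericalRange A))
  have hK : IsCompact K := (isBounded_convexHull.2 (isBounded_numericalRange A)).isCompact_closure
  have hpqK : ∀ z ∈ K, ‖p.eval z‖ ≤ c * ‖q.eval z‖ := fun z hz =>
    closure_minimal hpq (isClosed_le p.continuous.norm (q.continuous.norm.const_mul c)) hz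
  have hqK : ∀ z ∈ K, q.eval z ≠ 0 := fun z hz hq => by
    have hp : p.eval z = 0 := by simpa [hq] using hpqK z hz
    obtain ⟨a, b, hab⟩ := hcop
    simpa [hp, hq] using congrArg (Polynomial.eval z) hab
  have henlarged : ∀ η > 0, ‖toEuclideanCLM (𝕜 := ℂ) (aeval A p) x‖ ≤
      (1 + √2) * (c + η) * ‖toEuclideanCLM (𝕜 := ℂ) (aeval A q) x‖ := fun η hη => by
    have hopen : IsOpen {z | ‖p.eval z‖ < (c + η) * ‖q.eval z‖} :=
      isOpen_lt p.continuous.norm (q.continuous.norm.const_mul _)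
    obtain ⟨ε, hε, hεpq⟩ := hK.exists_cthickening_subset_open hopen fun z hz =>
      (hpqK z hz).trans_lt <| by
        have := norm_pos_iff.2 (hqK z hz)
        gcongr
        exact lt_add_of_pos_right c hη
    obtain ⟨γ, hKγ, hγ⟩ := exists_convexCurve hK (convex_convexHull ℝ _).closure
      (numericalRange_nonempty A).convexHull.closure hε
    exact norm_aeval_le_of_closure_subset_region
      ((closure_mono (subset_convexHull ℝ _)).trans hKγ) (by positivity)
      (fun z hz => hεpq (hγ hz)) x
  have hlim : Tendsto (fun η : ℝ => (1 + √2) * (c + η) * ‖toEuclideanCLM (𝕜 := ℂ) (aeval A q) x‖)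
      (𝓝[>] 0) (𝓝 ((1 + √2) * (c + 0) * ‖toEuclideanCLM (𝕜 := ℂ) (aeval A q) x‖)) :=
    Tendsto.mono_left (Continuous.tendsto (by fun_prop) 0) nhdsWithin_le_nhds
  rw [add_zero] at hlim
  exact ge_of_tendsto hlim (eventually_nhdsWithin_of_forall henlarged)

end CrouzeixPalencia

/-! ### Low-rank approximation of solutions of Sylvester equations -/

section Rank

variable {ι κ K : Type*} [Fintype κ] [Field K]

lemma rank_add_le (M N : Matrix ι κ K) : (M + N).rank ≤ M.rank + N.rank := by
  rw [Matrix.rank, mulVecLin_add]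
  refine (Submodule.finrank_mono ?_).trans (Submodule.finrank_add_le_finrank_add_finrank _ _)
  rintro _ ⟨x, rfl⟩
  exact Submodule.add_mem_sup ⟨x, rfl⟩ ⟨x, rfl⟩

lemma rank_neg (M : Matrix ι κ K) : (-M).rank = M.rank := by
  rw [← neg_one_smul K M]
  exact rank_smul_of_mem_nonZeroDivisors M (mem_nonZeroDivisors_of_ne_zero (by simp))

end Rank

section Sylvester

variable {ι κ K : Type*} [Fintype ι] [Fintype κ] [DecidableEq ι] [Field K]

/-- The block Krylov space generated by the columns of `L, B L, …, B ^ (h - 1) L`. -/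
def krylovSpace (B : Matrix ι ι K) (L : Matrix ι κ K) (h : ℕ) : Submodule K (ι → K) :=
  (Finset.range h).sup fun a => LinearMap.range (B ^ a * L).mulVecLin

lemma finrank_krylovSpace_le (B : Matrix ι ι K) (L : Matrix ι κ K) (h : ℕ) :
    Module.finrank K (krylovSpace B L h) ≤ h * L.rank := by
  induction h with
  | zero => rw [krylovSpace, Finset.range_zero, Finset.sup_empty, finrank_bot, zero_mul]
  | succ h ih =>
    rw [krylovSpace, Finset.range_add_one, Finset.sup_insert, add_mul, one_mul, add_comm]
    exact (Submodule.finrank_add_le_finrank_add_finrank _ _).trans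
      (add_le_add (rank_mul_le_right _ _) ih)

lemma pow_mul_mulVec_mem_krylovSpace (B : Matrix ι ι K) (L : Matrix ι κ K) {a h : ℕ} (ha : a < h)
    (v : κ → K) : (B ^ a * L) *ᵥ v ∈ krylovSpace B L h := by
  have hle : LinearMap.range (B ^ a * L).mulVecLin ≤ krylovSpace B L h :=
    Finset.le_sup (f := fun a => LinearMap.range (B ^ a * L).mulVecLin) (Finset.mem_range.2 ha)
  exact hle ⟨v, rfl⟩

variable [DecidableEq κ] (B : Matrix ι ι K) (Y : Matrix ι κ K) (D : Matrix κ κ K)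

lemma pow_add_mul_sub_mulVec_mem_krylovSpace {h j m : ℕ} (hjm : j + m ≤ h) (v : κ → K) :
    (B ^ (j + m) * Y * D ^ j - B ^ j * Y * D ^ (j + m)) *ᵥ v ∈
      krylovSpace B (B * Y - Y * D) h := by
  induction m generalizing v with
  | zero => simp
  | succ m ih =>
    have htelescope : B ^ (j + (m + 1)) * Y * D ^ j - B ^ j * Y * D ^ (j + (m + 1)) =
        B ^ (j + m) * (B * Y - Y * D) * D ^ j +
          (B ^ (j + m) * Y * D ^ j - B ^ j * Y * D ^ (j + m)) * D := by
      have hD : D ^ j * D = D * D ^ j := (Commute.pow_self D j).eq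
      simp only [← add_assoc, pow_succ, Matrix.mul_sub, Matrix.sub_mul, Matrix.mul_assoc, hD]
      abel
    rw [htelescope, add_mulVec, ← mulVec_mulVec, ← mulVec_mulVec v _ D]
    exact add_mem (pow_mul_mulVec_mem_krylovSpace _ _ (by lia) _) (ih (by lia) _)

lemma pow_mul_sub_mulVec_mem_krylovSpace {h i j : ℕ} (hi : i ≤ h) (hj : j ≤ h) (v : κ → K) :
    (B ^ i * Y * D ^ j - B ^ j * Y * D ^ i) *ᵥ v ∈ krylovSpace B (B * Y - Y * D) h := by
  wlog hij : j ≤ i generalizing i j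
  · rw [← neg_sub (B ^ j * Y * D ^ i), neg_mulVec]
    exact neg_mem (this hj hi (le_of_not_ge hij))
  obtain ⟨m, rfl⟩ := Nat.exists_eq_add_of_le hij
  exact pow_add_mul_sub_mulVec_mem_krylovSpace B Y D hi v

lemma aeval_mul_mul_aeval_eq_sum {p q : K[X]} {h : ℕ} (hp : p.natDegree < h)
    (hq : q.natDegree < h) :
    aeval B p * Y * aeval D q = ∑ i ∈ Finset.range h, ∑ j ∈ Finset.range h,
      (p.coeff i * q.coeff j) • (B ^ i * Y * D ^ j) := by
  rw [Finset.sum_comm]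
  simp only [aeval_eq_sum_range' hp, aeval_eq_sum_range' hq, Matrix.sum_mul, Matrix.mul_sum,
    Matrix.smul_mul, Matrix.mul_smul, Finset.smul_sum, smul_smul, mul_comm]

lemma rank_aeval_mul_sub_le {p q : K[X]} {h : ℕ} (hp : p.natDegree ≤ h) (hq : q.natDegree ≤ h) :
    (aeval B p * Y * aeval D q - aeval B q * Y * aeval D p).rank ≤ h * (B * Y - Y * D).rank := by
  refine le_trans (Submodule.finrank_mono ?_) (finrank_krylovSpace_le B (B * Y - Y * D) h)
  rintro _ ⟨v, rfl⟩
  have hp' := Nat.lt_succ_of_le hp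
  have hq' := Nat.lt_succ_of_le hq
  have hsum : aeval B p * Y * aeval D q - aeval B q * Y * aeval D p =
      ∑ i ∈ Finset.range (h + 1), ∑ j ∈ Finset.range (h + 1),
        (p.coeff i * q.coeff j) • (B ^ i * Y * D ^ j - B ^ j * Y * D ^ i) := by
    rw [aeval_mul_mul_aeval_eq_sum B Y D hp' hq', aeval_mul_mul_aeval_eq_sum B Y D hq' hp',
      Finset.sum_comm (f := fun i j => (q.coeff i * p.coeff j) • (B ^ i * Y * D ^ j))]
    simp only [smul_sub, Finset.sum_sub_distrib, mul_comm]
  rw [hsum, mulVecLin_apply, sum_mulVec]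
  simp only [sum_mulVec, smul_mulVec]
  refine sum_mem fun i hi => sum_mem fun j hj => Submodule.smul_mem _ _ ?_
  exact pow_mul_sub_mulVec_mem_krylovSpace B Y D (Finset.mem_range_succ_iff.1 hi)
    (Finset.mem_range_succ_iff.1 hj) v

end Sylvester

section Approximation

variable {ι κ : Type*} [Fintype ι] [Fintype κ] [DecidableEq ι] [DecidableEq κ]
  {A : Matrix ι ι ℂ} {p q : ℂ[X]} {c : ℝ}

lemma isUnit_aeval_of_numericalRange (hcop : IsCoprime p q) (hc : 0 ≤ c)
    (hpq : ∀ z ∈ convexHull ℝ (numericalRange A), ‖p.eval z‖ ≤ c * ‖q.eval z‖) :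
    IsUnit (aeval A q) := by
  rw [isUnit_iff_isUnit_det, isUnit_iff_ne_zero]
  intro hdet
  obtain ⟨v, hv, hqv⟩ := exists_mulVec_eq_zero_iff.2 hdet
  have hpv : aeval A p *ᵥ v = 0 := by
    have hle := norm_aeval_le_of_numericalRange hcop hc hpq (WithLp.toLp 2 v)
    rwa [toEuclideanCLM_toLp, toEuclideanCLM_toLp, hqv, WithLp.toLp_zero, norm_zero, mul_zero,
      norm_le_zero_iff, WithLp.toLp_eq_zero] at hle
  obtain ⟨a, b, hab⟩ := hcop
  have hbezout := congrArg (fun r => aeval A r *ᵥ v) hab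
  simp only [map_add, map_mul, map_one, add_mulVec, ← mulVec_mulVec, hpv, hqv, mulVec_zero,
    add_zero, one_mulVec] at hbezout
  exact hv hbezout.symm

lemma norm_aeval_mul_inv_le (hcop : IsCoprime p q) (hc : 0 ≤ c)
    (hpq : ∀ z ∈ convexHull ℝ (numericalRange A), ‖p.eval z‖ ≤ c * ‖q.eval z‖) :
    ‖aeval A p * (aeval A q)⁻¹‖ ≤ (1 + √2) * c := by
  have hunit := isUnit_aeval_of_numericalRange hcop hc hpq
  rw [cstar_norm_def]
  refine ContinuousLinearMap.opNorm_le_bound _ (by positivity) fun x => ?_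
  have hle := norm_aeval_le_of_numericalRange hcop hc hpq
    (toEuclideanCLM (𝕜 := ℂ) (aeval A q)⁻¹ x)
  rwa [← mul_apply_eq_comp, ← mul_apply_eq_comp, ← map_mul, ← map_mul,
    mul_nonsing_inv _ ((isUnit_iff_isUnit_det _).1 hunit), map_one] at hle

lemma inv_aeval_mul_aeval_comm (hunit : IsUnit (aeval A q)) :
    (aeval A q)⁻¹ * aeval A p = aeval A p * (aeval A q)⁻¹ := by
  have hcomm : Commute (aeval A q) (aeval A p) := by
    rw [Commute, SemiconjBy, ← map_mul, ← map_mul, mul_comm]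
  obtain ⟨u, hu⟩ := hunit
  rw [← hu] at hcomm ⊢
  rw [← coe_units_inv]
  exact hcomm.units_inv_left.eq

omit [DecidableEq ι] in
lemma exists_rank_le_norm_sub_le (B : Matrix ι ι ℂ) (Y : Matrix ι κ ℂ) (D : Matrix κ κ ℂ)
    (hcop : IsCoprime p q) {h : ℕ} (hp : p.natDegree ≤ h) (hq : q.natDegree ≤ h) {b d : ℝ}
    (hb : 0 ≤ b) (hd : 0 ≤ d)
    (hB : ∀ z ∈ convexHull ℝ (numericalRange B), ‖p.eval z‖ ≤ b * ‖q.eval z‖)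
    (hD : ∀ z ∈ convexHull ℝ (numericalRange D), ‖q.eval z‖ ≤ d * ‖p.eval z‖) :
    ∃ R : Matrix ι κ ℂ, R.rank ≤ h * (B * Y - Y * D).rank ∧
      ‖Y - R‖ ≤ (1 + √2) ^ 2 * (b * d) * ‖Y‖ := by
  classical
  have unitB := isUnit_aeval_of_numericalRange hcop hb hB
  have detB := (isUnit_iff_isUnit_det _).1 unitB
  have detD := (isUnit_iff_isUnit_det _).1 (isUnit_aeval_of_numericalRange hcop.symm hd hD)
  set Δ := aeval B p * Y * aeval D q - aeval B q * Y * aeval D p with hΔ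
  refine ⟨-((aeval B q)⁻¹ * Δ * (aeval D p)⁻¹), ?_, ?_⟩
  · rw [rank_neg]
    exact ((rank_mul_le_left _ _).trans (rank_mul_le_right _ _)).trans
      (rank_aeval_mul_sub_le B Y D hp hq)
  have herror : Y - -((aeval B q)⁻¹ * Δ * (aeval D p)⁻¹) =
      (aeval B p * (aeval B q)⁻¹) * Y * (aeval D q * (aeval D p)⁻¹) := by
    calc Y - -((aeval B q)⁻¹ * Δ * (aeval D p)⁻¹)
        = Y + ((aeval B q)⁻¹ * aeval B p * Y * (aeval D q * (aeval D p)⁻¹) -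
          (aeval B q)⁻¹ * aeval B q * Y * (aeval D p * (aeval D p)⁻¹)) := by
          rw [hΔ, sub_neg_eq_add]
          simp only [Matrix.mul_sub, Matrix.sub_mul, Matrix.mul_assoc]
      _ = _ := by
          rw [nonsing_inv_mul _ detB, mul_nonsing_inv _ detD, inv_aeval_mul_aeval_comm unitB,
            Matrix.one_mul, Matrix.mul_one, add_sub_cancel]
  calc ‖Y - -((aeval B q)⁻¹ * Δ * (aeval D p)⁻¹)‖
      ≤ ‖aeval B p * (aeval B q)⁻¹‖ * ‖Y‖ * ‖aeval D q * (aeval D p)⁻¹‖ := by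
        rw [herror]
        exact (l2_opNorm_mul _ _).trans (by gcongr; exact l2_opNorm_mul _ _)
    _ ≤ ((1 + √2) * b) * ‖Y‖ * ((1 + √2) * d) := by
        gcongr
        exacts [norm_aeval_mul_inv_le hcop hb hB, norm_aeval_mul_inv_le hcop.symm hd hD]
    _ = (1 + √2) ^ 2 * (b * d) * ‖Y‖ := by ring

end Approximation

/-! ### Singular values and complex approximations of real matrices -/

section RealAndImaginaryParts

variable {ι κ : Type*} [Fintype κ]

/-- The entrywise real part of a complex vector. -/
def reVec (x : EuclideanSpace ℂ κ) : EuclideanSpace ℝ κ := WithLp.toLp 2 fun i => (x i).re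

/-- The entrywise imaginary part of a complex vector. -/
def imVec (x : EuclideanSpace ℂ κ) : EuclideanSpace ℝ κ := WithLp.toLp 2 fun i => (x i).im

lemma norm_sq_eq_reVec_add_imVec (x : EuclideanSpace ℂ κ) :
    ‖x‖ ^ 2 = ‖reVec x‖ ^ 2 + ‖imVec x‖ ^ 2 := by
  simp only [EuclideanSpace.norm_sq_eq, reVec, imVec, ← Finset.sum_add_distrib, Real.norm_eq_abs,
    sq_abs, ← Complex.normSq_eq_norm_sq, Complex.normSq_apply, ← sq]

variable [DecidableEq κ]

lemma norm_sq_toComplex_mulVec [Fintype ι] (Y : Matrix ι κ ℝ) (x : EuclideanSpace ℂ κ) :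
    ‖(WithLp.toLp 2 (toComplex Y *ᵥ x.ofLp) : EuclideanSpace ℂ ι)‖ ^ 2 =
      ‖toEuclideanLin Y (reVec x)‖ ^ 2 + ‖toEuclideanLin Y (imVec x)‖ ^ 2 := by
  rw [norm_sq_eq_reVec_add_imVec]
  congr 3 <;> ext i <;> simp [reVec, imVec, toComplex, mulVec, dotProduct, toLpLin_apply]

lemma norm_toComplex_le (X : Matrix κ κ ℝ) : ‖toComplex X‖ ≤ spectralNorm X := by
  have hreal (y : EuclideanSpace ℝ κ) :
      ‖toEuclideanLin X y‖ ^ 2 ≤ spectralNorm X ^ 2 * ‖y‖ ^ 2 := by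
    rw [← mul_pow]
    gcongr
    exact (toEuclideanCLM (𝕜 := ℝ) X).le_opNorm y
  have hnonneg : 0 ≤ spectralNorm X := norm_nonneg _
  rw [cstar_norm_def]
  refine ContinuousLinearMap.opNorm_le_bound _ hnonneg fun x => ?_
  refine le_of_sq_le_sq ?_ (by positivity)
  calc ‖toEuclideanCLM (𝕜 := ℂ) (toComplex X) x‖ ^ 2
      = ‖toEuclideanLin X (reVec x)‖ ^ 2 + ‖toEuclideanLin X (imVec x)‖ ^ 2 :=
        norm_sq_toComplex_mulVec X x
    _ ≤ spectralNorm X ^ 2 * ‖reVec x‖ ^ 2 + spectralNorm X ^ 2 * ‖imVec x‖ ^ 2 :=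
        add_le_add (hreal _) (hreal _)
    _ = (spectralNorm X * ‖x‖) ^ 2 := by
        rw [mul_pow, norm_sq_eq_reVec_add_imVec x, mul_add]

end RealAndImaginaryParts

section SingularValues

variable {E F : Type*} [NormedAddCommGroup E] [InnerProductSpace ℝ E] [FiniteDimensional ℝ E]
  [NormedAddCommGroup F] [InnerProductSpace ℝ F] [FiniteDimensional ℝ F]

lemma norm_sq_map_sum_eigenvectorBasis (T : E →ₗ[ℝ] F) {ι : Type*} [Fintype ι]
    (c : ι ↪ Fin (Module.finrank ℝ E)) (a : ι → ℝ) :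
    ‖T (∑ i, a i • T.isSymmetric_adjoint_comp_self.eigenvectorBasis rfl (c i))‖ ^ 2 =
      ∑ i, T.singularValues (c i) ^ 2 * a i ^ 2 := by
  set B := T.isSymmetric_adjoint_comp_self.eigenvectorBasis rfl with hB
  have hon : Orthonormal ℝ (fun i => B (c i)) := B.orthonormal.comp c c.injective
  have heigen (i : ι) : (LinearMap.adjoint T ∘ₗ T) (B (c i)) =
      (T.singularValues (c i) ^ 2) • B (c i) := by
    rw [hB, T.isSymmetric_adjoint_comp_self.apply_eigenvectorBasis rfl,
      T.sq_singularValues_fin rfl (c i)]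
    rfl
  rw [← real_inner_self_eq_norm_sq, ← LinearMap.adjoint_inner_left, ← LinearMap.comp_apply,
    map_sum]
  simp only [map_smul, heigen, smul_smul]
  rw [hon.inner_sum]
  refine Finset.sum_congr rfl fun i _ => ?_
  rw [conj_trivial]
  ring

lemma exists_submodule_singularValues_mul_norm_le (T : E →ₗ[ℝ] F) {k : ℕ}
    (hk : k < Module.finrank ℝ E) :
    ∃ S : Submodule ℝ E, Module.finrank ℝ S = k + 1 ∧
      ∀ x ∈ S, T.singularValues k * ‖x‖ ≤ ‖T x‖ := by
  set B := T.isSymmetric_adjoint_comp_self.eigenvectorBasis rfl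
  let c : Fin (k + 1) ↪ Fin (Module.finrank ℝ E) := Fin.castLEEmb hk
  have hon : Orthonormal ℝ (fun i => B (c i)) := B.orthonormal.comp c c.injective
  refine ⟨Submodule.span ℝ (Set.range fun i => B (c i)), ?_, fun x hx => ?_⟩
  · rw [finrank_span_eq_card hon.linearIndependent, Fintype.card_fin]
  obtain ⟨a, rfl⟩ := (Submodule.mem_span_range_iff_exists_fun ℝ).1 hx
  refine le_of_sq_le_sq ?_ (norm_nonneg _)
  have hnorm : ‖∑ i, a i • B (c i)‖ ^ 2 = ∑ i, a i ^ 2 := by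
    rw [← real_inner_self_eq_norm_sq, hon.inner_sum]
    simp [sq]
  rw [mul_pow, hnorm, norm_sq_map_sum_eigenvectorBasis T c, Finset.mul_sum]
  gcongr with i
  · exact T.singularValues_nonneg k
  · exact T.singularValues_antitone (Nat.lt_succ_iff.1 i.2)

end SingularValues

section Matrices

variable {ι κ : Type*} [Fintype κ]

lemma exists_ne_zero_mulVec_eq_zero (S : Submodule ℝ (EuclideanSpace ℝ κ)) {R : Matrix ι κ ℂ}
    (hR : R.rank < Module.finrank ℝ S) :
    ∃ x : EuclideanSpace ℂ κ, x ≠ 0 ∧ R *ᵥ x.ofLp = 0 ∧ reVec x ∈ S ∧ imVec x ∈ S := by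
  set b := Module.finBasis ℝ S
  let Ψ := Fintype.linearCombination ℂ fun i (j : κ) => ((b i : EuclideanSpace ℝ κ) j : ℂ)
  obtain ⟨a, hker, ha⟩ := Submodule.exists_mem_ne_zero_of_ne_bot
    (LinearMap.ker_ne_bot_of_finrank_lt (f := R.mulVecLin.rangeRestrict ∘ₗ Ψ)
      (by rwa [Module.finrank_fin_fun]))
  set x : EuclideanSpace ℂ κ := WithLp.toLp 2 (Ψ a) with hx
  have hre : reVec x = (∑ i, (a i).re • b i : S) := by
    ext j
    simp [reVec, hx, Ψ, Fintype.linearCombination_apply]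
  have him : imVec x = (∑ i, (a i).im • b i : S) := by
    ext j
    simp [imVec, hx, Ψ, Fintype.linearCombination_apply]
  refine ⟨x, fun hx0 => ha ?_, congrArg Subtype.val hker, hre ▸ Subtype.property _,
    him ▸ Subtype.property _⟩
  have hre0 : ∑ i, (a i).re • b i = 0 := Subtype.ext (hre.symm.trans (by ext; simp [hx0, reVec]))
  have him0 : ∑ i, (a i).im • b i = 0 := Subtype.ext (him.symm.trans (by ext; simp [hx0, imVec]))
  exact funext fun i => Complex.ext (Fintype.linearIndependent_iff.1 b.linearIndependent _ hre0 i)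
    (Fintype.linearIndependent_iff.1 b.linearIndependent _ him0 i)

variable [Fintype ι] [DecidableEq κ]

lemma singularValue_le_norm_sub (Y : Matrix ι κ ℝ) {R : Matrix ι κ ℂ} {k : ℕ} (hR : R.rank ≤ k) :
    singularValue Y (k + 1) ≤ ‖toComplex Y - R‖ := by
  rw [singularValue, Nat.add_sub_cancel]
  set T := toEuclideanLin Y
  rcases le_or_gt (Module.finrank ℝ (EuclideanSpace ℝ κ)) k with hk | hk
  · rw [T.singularValues_of_finrank_le hk]
    exact norm_nonneg _
  obtain ⟨S, hS, hTS⟩ := exists_submodule_singularValues_mul_norm_le T hk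
  obtain ⟨x, hx, hRx, hre, him⟩ := exists_ne_zero_mulVec_eq_zero S
    (hR.trans_lt (hS ▸ Nat.lt_succ_self k))
  have hYx : toComplex Y *ᵥ x.ofLp = (toComplex Y - R) *ᵥ x.ofLp := by
    rw [sub_mulVec, hRx, sub_zero]
  have hlower : T.singularValues k * ‖x‖ ≤
      ‖(WithLp.toLp 2 (toComplex Y *ᵥ x.ofLp) : EuclideanSpace ℂ ι)‖ := by
    refine le_of_sq_le_sq ?_ (norm_nonneg _)
    have hnonneg := T.singularValues_nonneg k
    rw [norm_sq_toComplex_mulVec, mul_pow, norm_sq_eq_reVec_add_imVec x, mul_add, ← mul_pow,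
      ← mul_pow]
    gcongr
    exacts [hTS _ hre, hTS _ him]
  rw [hYx] at hlower
  exact le_of_mul_le_mul_right (hlower.trans (l2_opNorm_mulVec _ x)) (norm_pos_iff.2 hx)

end Matrices

/-! ### Compressions, Sylvester equations and Zolotarev numbers -/

section ToComplex

variable {ι κ μ : Type*}

lemma toComplex_add (M N : Matrix ι κ ℝ) : toComplex (M + N) = toComplex M + toComplex N :=
  Matrix.map_add _ Complex.ofReal_add M N

lemma toComplex_injective : Function.Injective (toComplex : Matrix ι κ ℝ → Matrix ι κ ℂ) :=
  Matrix.map_injective Complex.ofReal_injective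

variable [Fintype κ]

lemma toComplex_mul (M : Matrix ι κ ℝ) (N : Matrix κ μ ℝ) :
    toComplex (M * N) = toComplex M * toComplex N :=
  Matrix.map_mul (f := Complex.ofRealHom)

lemma exists_eq_mul_of_rank {K : Type*} [Field K] (M : Matrix ι κ K) :
    ∃ (U : Matrix ι (Fin M.rank) K) (V : Matrix (Fin M.rank) κ K), M = U * V := by
  classical
  let b : Module.Basis (Fin M.rank) K (LinearMap.range M.mulVecLin) := Module.finBasis K _
  let col (j : κ) : LinearMap.range M.mulVecLin := ⟨M.col j, Pi.single j 1, by simp⟩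
  refine ⟨of fun i k => (b k : ι → K) i, of fun k j => b.repr (col j) k, ?_⟩
  ext i j
  have hcol : M.col j = ∑ k, b.repr (col j) k • (b k : ι → K) := by
    simpa only [AddSubmonoidClass.coe_finsetSum, Submodule.coe_smul] using
      congrArg Subtype.val (b.sum_repr (col j)).symm
  simpa [Matrix.mul_apply, mul_comm] using congrFun hcol i

lemma rank_toComplex_le (M : Matrix ι κ ℝ) : (toComplex M).rank ≤ M.rank := by
  obtain ⟨U, V, hUV⟩ := exists_eq_mul_of_rank M
  calc (toComplex M).rank ≤ (toComplex U).rank := by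
        conv_lhs => rw [hUV, toComplex_mul]
        exact rank_mul_le_left _ _
    _ ≤ M.rank := (rank_le_card_width _).trans_eq (Fintype.card_fin _)

end ToComplex

section Compression

variable {ι κ μ : Type*} [Fintype ι] [DecidableEq ι]

/-- The matrix of the map `v ↦ ∑ i, v i • e_{f i}`, which for injective `f` extends vectors by
zero along `f`. -/
def selection (f : κ → ι) : Matrix ι κ ℂ := (1 : Matrix ι ι ℂ).submatrix id f

lemma conjTranspose_selection_mul_mul (M : Matrix ι ι ℂ) (f : κ → ι) (g : μ → ι) :
    (selection f)ᴴ * M * selection g = M.submatrix f g := by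
  ext i j
  simp [selection, Matrix.mul_apply, Matrix.one_apply]

variable [Fintype κ]

lemma norm_selection_le [DecidableEq κ] {f : κ → ι} (hf : Function.Injective f) :
    ‖selection f‖ ≤ 1 := by
  have hmul : (selection f)ᴴ * selection f = 1 := by
    simpa [submatrix_one f hf] using conjTranspose_selection_mul_mul 1 f f
  refine le_of_sq_le_sq ?_ zero_le_one
  rw [sq, ← l2_opNorm_conjTranspose_mul_self, hmul, ← diagonal_one, l2_opNorm_diagonal, one_pow]
  exact (pi_norm_le_iff_of_nonneg zero_le_one).2 fun i => by simp

lemma norm_submatrix_le [Fintype μ] [DecidableEq μ] (M : Matrix ι ι ℂ) {f : κ → ι}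
    {g : μ → ι} (hf : Function.Injective f) (hg : Function.Injective g) :
    ‖M.submatrix f g‖ ≤ ‖M‖ := by
  classical
  rw [← conjTranspose_selection_mul_mul]
  calc ‖(selection f)ᴴ * M * selection g‖ ≤ ‖(selection f)ᴴ‖ * ‖M‖ * ‖selection g‖ :=
        (l2_opNorm_mul _ _).trans (by gcongr; exact l2_opNorm_mul _ _)
    _ ≤ 1 * ‖M‖ * 1 := by
        rw [l2_opNorm_conjTranspose]
        gcongr
        exacts [norm_selection_le hf, norm_selection_le hg]
    _ = ‖M‖ := by ring

end Compression

section NumericalRange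

variable {ι κ : Type*} [Fintype ι] [Fintype κ]

lemma norm_eq_one_iff_dotProduct (x : EuclideanSpace ℂ ι) :
    ‖x‖ = 1 ↔ star x.ofLp ⬝ᵥ x.ofLp = 1 := by
  rw [dotProduct_comm, ← EuclideanSpace.inner_eq_star_dotProduct, inner_self_eq_norm_sq_to_K,
    ← pow_eq_one_iff_of_nonneg (norm_nonneg x) two_ne_zero]
  norm_cast
  exact Complex.ofReal_eq_one.symm

lemma numericalRange_submatrix_subset (M : Matrix ι ι ℂ) {f : κ → ι} (hf : Function.Injective f) :
    numericalRange (M.submatrix f f) ⊆ numericalRange M := by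
  classical
  rintro _ ⟨x, hx, rfl⟩
  have hform (N : Matrix ι ι ℂ) : star (selection f *ᵥ x.ofLp) ⬝ᵥ (N *ᵥ (selection f *ᵥ x.ofLp)) =
      star x.ofLp ⬝ᵥ (N.submatrix f f *ᵥ x.ofLp) := by
    rw [← conjTranspose_selection_mul_mul, star_mulVec, ← dotProduct_mulVec, mulVec_mulVec,
      mulVec_mulVec]
  refine ⟨WithLp.toLp 2 (selection f *ᵥ x.ofLp), ?_, (hform M).symm⟩
  rw [norm_eq_one_iff_dotProduct] at hx ⊢
  simpa [submatrix_one f hf, hx] using hform 1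

lemma numericalRange_transpose_subset (M : Matrix ι ι ℂ) :
    numericalRange Mᵀ ⊆ numericalRange M := by
  rintro _ ⟨x, hx, rfl⟩
  refine ⟨WithLp.toLp 2 (star x.ofLp), ?_, ?_⟩
  · rw [norm_eq_one_iff_dotProduct] at hx ⊢
    simpa [dotProduct_comm] using hx
  · rw [star_star, mulVec_transpose, dotProduct_comm, ← dotProduct_mulVec]

lemma numericalRange_neg_subset (M : Matrix ι ι ℂ) : numericalRange (-M) ⊆ -numericalRange M := by
  rintro _ ⟨x, hx, rfl⟩
  exact ⟨x, hx, by rw [neg_mulVec, dotProduct_neg, neg_neg]⟩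

end NumericalRange

section Uniqueness

variable {ι : Type*} [Fintype ι] [DecidableEq ι]

lemma aeval_mul_eq_mul_aeval {R S : Type*} [CommRing R] [Ring S] [Algebra R S] {G D C : S}
    (h : G * D = D * C) (p : R[X]) : aeval G p * D = D * aeval C p := by
  have hpow (k : ℕ) : G ^ k * D = D * C ^ k := (SemiconjBy.pow_right h.symm k).eq.symm
  simp only [aeval_eq_sum_range, Finset.sum_mul, Finset.mul_sum, smul_mul_assoc, mul_smul_comm,
    hpow]

lemma eq_zero_of_sylvester {G C D : Matrix ι ι ℂ} (hG : ∀ μ ∈ spectrum ℂ G, μ.re ≤ 0)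
    (hC : numericalRange C ⊆ leftHalfPlane) (h : G * D + D * C = 0) : D = 0 := by
  rcases isEmpty_or_nonempty ι with hι | hι
  · exact Subsingleton.elim _ _
  have hdeg : 0 < G.charpoly.degree := by
    rw [charpoly_degree_eq_dim]
    exact_mod_cast Fintype.card_pos
  have hunit : IsUnit (aeval (-C) G.charpoly) := by
    rw [← spectrum.zero_notMem_iff ℂ, spectrum.map_polynomial_aeval_of_degree_pos _ _ hdeg]
    rintro ⟨μ, hμC, hμG⟩
    rw [← spectrum.neg_eq, Set.mem_neg, mem_spectrum_iff_isRoot_charpoly] at hμC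
    have hre : (-μ).re < 0 := hC (mem_numericalRange_of_isRoot_charpoly hμC)
    rw [Complex.neg_re, neg_lt_zero] at hre
    exact (hG μ (mem_spectrum_iff_isRoot_charpoly.2 hμG)).not_gt hre
  have hzero := aeval_mul_eq_mul_aeval (C := -C)
    ((eq_neg_of_add_eq_zero_left h).trans (Matrix.mul_neg D C).symm) G.charpoly
  rw [aeval_self_charpoly, Matrix.zero_mul] at hzero
  exact hunit.mul_left_eq_zero.1 hzero.symm

end Uniqueness

section Zolotarev

variable {h : ℕ} {E G : Set ℂ} {g : RatFunc ℂ}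

lemma one_mem_zolotarevAdmissible (h : ℕ) (E G : Set ℂ) : 1 ∈ zolotarevAdmissible h E G := by
  have hone (z : ℂ) : ratAbs 1 z = 1 := by simp [ratAbs]
  refine ⟨by simp, by simp, ?_, ?_⟩
  · simp only [hone]
    exact ne_top_of_le_ne_top ENNReal.one_ne_top (iSup₂_le fun _ _ => le_rfl)
  · simp only [hone]
    exact (one_pos.trans_le (le_iInf₂ fun _ _ => le_rfl)).ne'

lemma norm_num_le_of_ratAbs_le {z : ℂ} {a : ℝ≥0∞} (ha : a ≠ ⊤) (hz : ratAbs g z ≤ a) :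
    ‖g.num.eval z‖ ≤ a.toReal * ‖g.denom.eval z‖ := by
  rw [ratAbs] at hz
  split_ifs at hz with hpole
  · exact absurd (top_le_iff.1 hz) ha
  · rwa [ENNReal.ofReal_le_iff_le_toReal ha, norm_div, div_le_iff₀ (norm_pos_iff.2 hpole)] at hz

lemma norm_denom_le_of_le_ratAbs {z : ℂ} {a : ℝ≥0∞} (ha : a ≠ 0) (hz : a ≤ ratAbs g z) :
    ‖g.denom.eval z‖ ≤ a⁻¹.toReal * ‖g.num.eval z‖ := by
  rw [ratAbs] at hz
  split_ifs at hz with hpole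
  · rw [hpole, norm_zero]
    positivity
  · have hfin : a ≠ ⊤ := ne_top_of_le_ne_top ENNReal.ofReal_ne_top hz
    have hpos := ENNReal.toReal_pos ha hfin
    rw [← ENNReal.ofReal_toReal hfin, ENNReal.ofReal_le_ofReal_iff (norm_nonneg _), norm_div,
      le_div_iff₀ (norm_pos_iff.2 hpole)] at hz
    rwa [ENNReal.toReal_inv, ← div_eq_inv_mul, le_div_iff₀' hpos]

lemma le_mul_zolotarev {x k : ℝ} (hk : 0 < k)
    (hx : ∀ (p q : ℂ[X]) (a b : ℝ), IsCoprime p q → p.natDegree ≤ h → q.natDegree ≤ h →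
      0 ≤ a → 0 ≤ b → (∀ z ∈ E, ‖p.eval z‖ ≤ a * ‖q.eval z‖) →
      (∀ z ∈ G, ‖q.eval z‖ ≤ b * ‖p.eval z‖) → x ≤ k * (a * b)) :
    x ≤ k * zolotarev h E G := by
  have hdiv : ∀ g ∈ zolotarevAdmissible h E G,
      (⨆ z ∈ E, ratAbs g z) / (⨅ z ∈ G, ratAbs g z) ≠ ⊤ :=
    fun g hg => ENNReal.div_ne_top hg.2.2.1 hg.2.2.2
  have hfin : (⨅ g ∈ zolotarevAdmissible h E G,
      (⨆ z ∈ E, ratAbs g z) / (⨅ z ∈ G, ratAbs g z)) ≠ ⊤ :=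
    ne_top_of_le_ne_top (hdiv 1 (one_mem_zolotarevAdmissible h E G))
      (iInf₂_le _ (one_mem_zolotarevAdmissible h E G))
  rw [← div_le_iff₀' hk, zolotarev, ← ENNReal.ofReal_le_iff_le_toReal hfin]
  refine le_iInf₂ fun g hg => ?_
  rw [ENNReal.ofReal_le_iff_le_toReal (hdiv g hg), div_eq_mul_inv _ (iInf _), ENNReal.toReal_mul,
    div_le_iff₀' hk]
  obtain ⟨hnum, hdenom, hsup, hinf⟩ := hg
  exact hx g.num g.denom _ _ (RatFunc.isCoprime_num_denom g) hnum hdenom ENNReal.toReal_nonneg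
    ENNReal.toReal_nonneg
    (fun z hz => norm_num_le_of_ratAbs_le hsup
      (le_iSup₂ (f := fun z (_ : z ∈ E) => ratAbs g z) z hz))
    (fun z hz => norm_denom_le_of_le_ratAbs hinf (iInf₂_le z hz))

end Zolotarev

/-! ### Off-diagonal blocks of Riccati solutions -/

lemma singularValue_le_of_sylvester {ι κ : Type*} [Fintype ι] [Fintype κ] [DecidableEq κ]
    {B : Matrix ι ι ℝ} {Y : Matrix ι κ ℝ} {D : Matrix κ κ ℝ} {E G : Set ℂ}
    (hB : convexHull ℝ (numericalRange (toComplex B)) ⊆ E)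
    (hD : convexHull ℝ (numericalRange (-toComplex D)) ⊆ G) {t : ℕ}
    (ht : (B * Y + Y * D).rank ≤ t) (h : ℕ) :
    singularValue Y (h * t + 1) ≤ (1 + √2) ^ 2 * ‖toComplex Y‖ * zolotarev h E G := by
  classical
  rcases eq_or_ne (toComplex Y) 0 with hY | hY
  · simpa [hY] using singularValue_le_norm_sub Y (R := 0) (k := h * t) (by simp)
  refine le_mul_zolotarev (by have := norm_pos_iff.2 hY; positivity)
    fun p q a b hcop hp hq ha hb hpE hqG => ?_
  obtain ⟨R, hR, hYR⟩ := exists_rank_le_norm_sub_le (toComplex B) (toComplex Y) (-toComplex D)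
    hcop hp hq ha hb (fun z hz => hpE z (hB hz)) (fun z hz => hqG z (hD hz))
  have hrank : R.rank ≤ h * t := by
    rw [Matrix.mul_neg, sub_neg_eq_add, ← toComplex_mul, ← toComplex_mul, ← toComplex_add] at hR
    exact hR.trans (Nat.mul_le_mul_left _ ((rank_toComplex_le _).trans ht))
  calc singularValue Y (h * t + 1) ≤ ‖toComplex Y - R‖ := singularValue_le_norm_sub Y hrank
    _ ≤ (1 + √2) ^ 2 * (a * b) * ‖toComplex Y‖ := hYR
    _ = (1 + √2) ^ 2 * ‖toComplex Y‖ * (a * b) := by ring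

lemma submatrix_mul_eq_add {K ι α β γ δ : Type*} [NonUnitalNonAssocSemiring K] [Fintype ι]
    [Fintype α] [Fintype β] (M N : Matrix ι ι K) {f : α → ι} {g : β → ι}
    (hfg : Function.Bijective (Sum.elim f g)) (a : γ → ι) (b : δ → ι) :
    (M * N).submatrix a b =
      M.submatrix a f * N.submatrix f b + M.submatrix a g * N.submatrix g b := by
  ext i j
  simp only [submatrix_apply, Matrix.mul_apply, Matrix.add_apply]
  exact (hfg.sum_comp fun x => M (a i) x * N x (b j)).symm.trans (Fintype.sum_sum_type _)

section Riccati

variable {ι α β : Type*} [Fintype ι] [Fintype α] [Fintype β] {A F Q X : Matrix ι ι ℝ}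

lemma transpose_closedLoop (hF : Fᵀ = F) (hX : Xᵀ = X) :
    (closedLoop A F X)ᵀ = Aᵀ - X * F := by
  rw [closedLoop, transpose_sub, transpose_mul, hF, hX]

variable {f : α → ι} {g : β → ι}

lemma sylvester_offDiagonal_block (hF : Fᵀ = F) (hX : Xᵀ = X)
    (hric : Aᵀ * X + X * A - X * F * X + Q = 0) (hfg : Function.Bijective (Sum.elim f g)) :
    ((closedLoop A F X).submatrix f f)ᵀ * X.submatrix f g +
      X.submatrix f g * (closedLoop A F X).submatrix g g =
      -((A.submatrix g f)ᵀ * X.submatrix g g) + -(X.submatrix f f * A.submatrix f g) +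
        X.submatrix f f * F.submatrix f g * X.submatrix g g +
        -(X.submatrix f g * F.submatrix g f * X.submatrix f g) + -Q.submatrix f g := by
  have hf : ((closedLoop A F X).submatrix f f)ᵀ = Aᵀ.submatrix f f - (X * F).submatrix f f := by
    rw [transpose_submatrix, transpose_closedLoop hF hX, submatrix_sub]
    rfl
  have hg : (closedLoop A F X).submatrix g g = A.submatrix g g - (F.submatrix g f *
      X.submatrix f g + F.submatrix g g * X.submatrix g g) := by
    rw [← submatrix_mul_eq_add F X hfg]
    rfl
  have hblock : (Aᵀ.submatrix f f * X.submatrix f g + Aᵀ.submatrix f g * X.submatrix g g) +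
      (X.submatrix f f * A.submatrix f g + X.submatrix f g * A.submatrix g g) -
      ((X * F).submatrix f f * X.submatrix f g +
        (X.submatrix f f * F.submatrix f g + X.submatrix f g * F.submatrix g g) *
          X.submatrix g g) + Q.submatrix f g = 0 := by
    rw [← submatrix_mul_eq_add X F hfg, ← submatrix_mul_eq_add X A hfg,
      ← submatrix_mul_eq_add Aᵀ X hfg, ← submatrix_mul_eq_add (X * F) X hfg]
    exact congrArg (fun M : Matrix ι ι ℝ => M.submatrix f g) hric
  rw [← sub_eq_zero, ← hblock, hf, hg, transpose_submatrix]
  simp only [Matrix.add_mul, Matrix.sub_mul, Matrix.mul_sub, Matrix.mul_add, Matrix.mul_assoc]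
  abel

lemma rank_sylvester_offDiagonal_block_le (hF : Fᵀ = F) (hX : Xᵀ = X)
    (hric : Aᵀ * X + X * A - X * F * X + Q = 0) (hfg : Function.Bijective (Sum.elim f g)) :
    (((closedLoop A F X).submatrix f f)ᵀ * X.submatrix f g +
      X.submatrix f g * (closedLoop A F X).submatrix g g).rank ≤
      (A.submatrix g f).rank + (A.submatrix f g).rank + (F.submatrix f g).rank +
        (F.submatrix g f).rank + (Q.submatrix f g).rank := by
  rw [sylvester_offDiagonal_block hF hX hric hfg]
  refine (rank_add_le _ _).trans (add_le_add ((rank_add_le _ _).trans (add_le_add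
    ((rank_add_le _ _).trans (add_le_add ((rank_add_le _ _).trans (add_le_add ?_ ?_)) ?_)) ?_)) ?_)
  · exact (rank_neg _).trans_le ((rank_mul_le_left _ _).trans (rank_transpose _).le)
  · exact (rank_neg _).trans_le (rank_mul_le_right _ _)
  · exact (rank_mul_le_left _ _).trans (rank_mul_le_right _ _)
  · exact (rank_neg _).trans_le ((rank_mul_le_left _ _).trans (rank_mul_le_right _ _))
  · exact (rank_neg _).le

lemma singularValue_offDiagonal_block_le [DecidableEq ι] [DecidableEq β] (hF : Fᵀ = F)
    (hX : Xᵀ = X) (hric : Aᵀ * X + X * A - X * F * X + Q = 0)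
    (hfg : Function.Bijective (Sum.elim f g)) {E : Set ℂ}
    (hE : convexHull ℝ (numericalRange (toComplex (closedLoop A F X))) ⊆ E) {t : ℕ}
    (ht : (A.submatrix g f).rank + (A.submatrix f g).rank + (F.submatrix f g).rank +
      (F.submatrix g f).rank + (Q.submatrix f g).rank ≤ t) (h : ℕ) :
    singularValue (X.submatrix f g) (h * t + 1) / spectralNorm X ≤
      (1 + √2) ^ 2 * zolotarev h E (-E) := by
  classical
  have hf : Function.Injective f := hfg.injective.comp Sum.inl_injective
  have hg : Function.Injective g := hfg.injective.comp Sum.inr_injective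
  set C := closedLoop A F X
  have hCf : convexHull ℝ (numericalRange (toComplex (C.submatrix f f)ᵀ)) ⊆ E :=
    (convexHull_mono ((numericalRange_transpose_subset (toComplex (C.submatrix f f))).trans
      (numericalRange_submatrix_subset (toComplex C) hf))).trans hE
  have hCg : convexHull ℝ (numericalRange (-toComplex (C.submatrix g g))) ⊆ -E := by
    refine (convexHull_mono ((numericalRange_neg_subset _).trans (Set.neg_subset_neg.2
      (numericalRange_submatrix_subset (toComplex C) hg)))).trans ?_
    rw [convexHull_neg]
    exact Set.neg_subset_neg.2 hE
  have hnorm : ‖toComplex (X.submatrix f g)‖ ≤ spectralNorm X :=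
    (norm_submatrix_le (toComplex X) hf hg).trans (norm_toComplex_le X)
  have hzol : 0 ≤ zolotarev h E (-E) := ENNReal.toReal_nonneg
  refine div_le_of_le_mul₀ (norm_nonneg _) (by positivity) ?_
  calc singularValue (X.submatrix f g) (h * t + 1)
      ≤ (1 + √2) ^ 2 * ‖toComplex (X.submatrix f g)‖ * zolotarev h E (-E) :=
        singularValue_le_of_sylvester hCf hCg
          ((rank_sylvester_offDiagonal_block_le hF hX hric hfg).trans ht) h
    _ ≤ (1 + √2) ^ 2 * spectralNorm X * zolotarev h E (-E) := by gcongr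
    _ = (1 + √2) ^ 2 * zolotarev h E (-E) * spectralNorm X := by ring

lemma eq_of_isStabilizingSolution [DecidableEq ι] {Y : Matrix ι ι ℝ} (hF : Fᵀ = F)
    (hX : IsStabilizingSolution A F Q X) (hY : Aᵀ * Y + Y * A - Y * F * Y + Q = 0)
    (hW : numericalRange (toComplex (closedLoop A F Y)) ⊆ leftHalfPlane) : Y = X := by
  have hXs : Xᵀ = X := by simpa using hX.posSemidef.isHermitian.eq
  have hreal : (closedLoop A F X)ᵀ * X + X * closedLoop A F Y =
      (closedLoop A F X)ᵀ * Y + Y * closedLoop A F Y := by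
    rw [transpose_closedLoop hF hXs, ← sub_eq_zero, ← sub_self (0 : Matrix ι ι ℝ)]
    nth_rw 1 [← hX.riccati]
    rw [← hY, closedLoop]
    noncomm_ring
  have hcomplex : (toComplex (closedLoop A F X))ᵀ * (toComplex X - toComplex Y) +
      (toComplex X - toComplex Y) * toComplex (closedLoop A F Y) = 0 := by
    have hmap := congrArg toComplex hreal
    simp only [toComplex_add, toComplex_mul] at hmap
    rw [Matrix.mul_sub, Matrix.sub_mul, sub_add_sub_comm, sub_eq_zero]
    exact hmap
  have hstable : ∀ μ ∈ spectrum ℂ (toComplex (closedLoop A F X))ᵀ, μ.re ≤ 0 := by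
    simpa only [mem_spectrum_iff_isRoot_charpoly, charpoly_transpose] using hX.stable
  exact toComplex_injective (sub_eq_zero.1 (eq_zero_of_sylvester hstable hW hcomplex)).symm

end Riccati

section Blocks

variable {n : ℕ}

lemma rank_lowerBlock_le_qsrank (M : Matrix (Fin n) (Fin n) ℝ) {s : ℕ} (hs : s ∈ Finset.Ico 1 n) :
    (lowerBlock M s).rank ≤ qsrank M :=
  (le_max_left _ _).trans
    (Finset.le_sup (f := fun s => max (lowerBlock M s).rank (upperBlock M s).rank) hs)

lemma rank_upperBlock_le_qsrank (M : Matrix (Fin n) (Fin n) ℝ) {s : ℕ} (hs : s ∈ Finset.Ico 1 n) :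
    (upperBlock M s).rank ≤ qsrank M :=
  (le_max_right _ _).trans
    (Finset.le_sup (f := fun s => max (lowerBlock M s).rank (upperBlock M s).rank) hs)

lemma bijective_sumElim_val {ι : Type*} {p q : ι → Prop} (hpq : ∀ i, p i ↔ ¬ q i) :
    Function.Bijective
      (Sum.elim (Subtype.val : {i // p i} → ι) (Subtype.val : {i // q i} → ι)) := by
  constructor
  · refine Function.Injective.sumElim Subtype.val_injective Subtype.val_injective ?_
    rintro ⟨a, ha⟩ ⟨b, hb⟩ rfl
    exact (hpq _).1 ha hb
  · intro i
    by_cases hi : q i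
    · exact ⟨Sum.inr ⟨i, hi⟩, rfl⟩
    · exact ⟨Sum.inl ⟨i, (hpq i).2 hi⟩, rfl⟩

lemma numericalRange_closedLoop_subset {A F Q X : Matrix (Fin n) (Fin n) ℝ} (hF : Fᵀ = F)
    (hX : IsStabilizingSolution A F Q X) {Y : Matrix (FirstIdx n n) (FirstIdx n n) ℝ}
    (hY : IsStabilizingSolution (leading A n) (leading F n) (leading Q n) Y)
    (hW : numericalRange (toComplex (closedLoop (leading A n) (leading F n) Y)) ⊆ leftHalfPlane) :
    numericalRange (toComplex (closedLoop A F X)) ⊆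
      numericalRange (toComplex (closedLoop (leading A n) (leading F n) Y)) := by
  let e : Fin n ≃ FirstIdx n n := ⟨fun i => ⟨i, i.2⟩, fun i => i, fun _ => rfl, fun _ => rfl⟩
  have hleading (M : Matrix (Fin n) (Fin n) ℝ) : (leading M n).submatrix e e = M := rfl
  have hclosed : (closedLoop (leading A n) (leading F n) Y).submatrix e e =
      closedLoop A F (Y.submatrix e e) := by
    rw [closedLoop, closedLoop, submatrix_sub, Pi.sub_apply, Pi.sub_apply,
      ← submatrix_mul_equiv _ _ e e e, hleading, hleading]
  have hrange : numericalRange (toComplex (closedLoop A F (Y.submatrix e e))) ⊆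
      numericalRange (toComplex (closedLoop (leading A n) (leading F n) Y)) := by
    rw [← hclosed]
    exact numericalRange_submatrix_subset
      (toComplex (closedLoop (leading A n) (leading F n) Y)) e.injective
  have hric : Aᵀ * Y.submatrix e e + Y.submatrix e e * A -
      Y.submatrix e e * F * Y.submatrix e e + Q = 0 := by
    have hsub := congrArg (fun M => M.submatrix e e) hY.riccati
    simp only [submatrix_add, submatrix_sub, Pi.add_apply, Pi.sub_apply,
      ← submatrix_mul_equiv _ _ e e e] at hsub
    exact hsub
  rwa [eq_of_isStabilizingSolution hF hX hric (hrange.trans hW)] at hrange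

lemma convexHull_numericalRange_closedLoop_subset {A F Q X : Matrix (Fin n) (Fin n) ℝ}
    (hF : Fᵀ = F) (hX : IsStabilizingSolution A F Q X)
    {Y : Matrix (FirstIdx n n) (FirstIdx n n) ℝ}
    (hY : IsStabilizingSolution (leading A n) (leading F n) (leading Q n) Y) {S E : Set ℂ}
    (hYS : numericalRange (toComplex (closedLoop (leading A n) (leading F n) Y)) ⊆ S)
    (hSE : convexHull ℝ S ⊆ E) (hE : E ⊆ leftHalfPlane) :
    convexHull ℝ (numericalRange (toComplex (closedLoop A F X))) ⊆ E :=
  (convexHull_mono ((numericalRange_closedLoop_subset hF hX hY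
    (hYS.trans ((subset_convexHull ℝ S).trans (hSE.trans hE)))).trans hYS)).trans hSE

end Blocks

end Care

end

theorem theorem2p2_general {n : ℕ} {A F Q X : Matrix (Fin n) (Fin n) ℝ} (hF : Fᵀ = F)
    (hX : Xᵀ = X) (hric : Aᵀ * X + X * A - X * F * X + Q = 0) {E : Set ℂ}
    (hE : convexHull ℝ (Care.numericalRange (Care.toComplex (Care.closedLoop A F X))) ⊆ E) {t : ℕ}
    (ht : 2 * Care.qsrank A + 2 * Care.qsrank F + Care.qsrank Q ≤ t) (h : ℕ) {s : ℕ}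
    (hs : s ∈ Finset.Ico 1 n) :
    Care.singularValue (Care.lowerBlock X s) (h * t + 1) / Care.spectralNorm X ≤
        (1 + √2) ^ 2 * Care.zolotarev h E (-E) ∧
      Care.singularValue (Care.upperBlock X s) (h * t + 1) / Care.spectralNorm X ≤
        (1 + √2) ^ 2 * Care.zolotarev h E (-E) := by
  have hlower (M : Matrix (Fin n) (Fin n) ℝ) := Care.rank_lowerBlock_le_qsrank M hs
  have hupper (M : Matrix (Fin n) (Fin n) ℝ) := Care.rank_upperBlock_le_qsrank M hs
  unfold Care.lowerBlock at hlower
  unfold Care.upperBlock at hupper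
  constructor
  · refine Care.singularValue_offDiagonal_block_le hF hX hric
      (Care.bijective_sumElim_val fun _ => not_lt.symm) hE ?_ h
    grind
  · refine Care.singularValue_offDiagonal_block_le hF hX hric
      (Care.bijective_sumElim_val fun _ => not_le.symm) hE ?_ h
    grind

theorem theorem2p2 {n : ℕ} (A F Q X : Matrix (Fin n) (Fin n) ℝ) (ra rf rq : ℕ)
    (hA : Care.qsrank A = ra) (hF : Care.qsrank F = rf) (hQ : Care.qsrank Q = rq)
    (hWA : Care.numericalRange (Care.toComplex A) ⊆ Care.leftHalfPlane)
    (hFpsd : F.PosSemidef) (hQpsd : Q.PosSemidef)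
    (hX : Care.IsStabilizingSolution A F Q X)
    (Xlead : (j : ℕ) → Matrix (Care.FirstIdx n j) (Care.FirstIdx n j) ℝ)
    (Xtrail : (j : ℕ) → Matrix (Care.LastIdx n j) (Care.LastIdx n j) ℝ)
    (hXlead : ∀ j ∈ Finset.Icc 1 n, Care.IsStabilizingSolution
      (Care.leading A j) (Care.leading F j) (Care.leading Q j) (Xlead j))
    (hXtrail : ∀ j ∈ Finset.Icc 1 n, Care.IsStabilizingSolution
      (Care.trailing A j) (Care.trailing F j) (Care.trailing Q j) (Xtrail j))
    (E : Set ℂ) (hE : E ⊆ Care.leftHalfPlane)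
    (hEhull : convexHull ℝ
      ((⋃ j ∈ Finset.Icc 1 n, Care.numericalRange (Care.toComplex
          (Care.closedLoop (Care.leading A j) (Care.leading F j) (Xlead j)))) ∪
        (⋃ j ∈ Finset.Icc 1 n, Care.numericalRange (Care.toComplex
          (Care.closedLoop (Care.trailing A j) (Care.trailing F j) (Xtrail j))))) ⊆ E)
    (h : ℕ) (hh : 1 ≤ h) (s : ℕ) (hs : s ∈ Finset.Ico 1 n) :
    Care.singularValue (Care.lowerBlock X s) (h * (4 * ra + 2 * rf + 2 * rq) + 1)
        / Care.spectralNorm X ≤ (1 + √2) ^ 2 * Care.zolotarev h E (-E) ∧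
    Care.singularValue (Care.upperBlock X s) (h * (4 * ra + 2 * rf + 2 * rq) + 1)
        / Care.spectralNorm X ≤ (1 + √2) ^ 2 * Care.zolotarev h E (-E) := by
  have hn : n ∈ Finset.Icc 1 n := by grind
  have hFsymm : Fᵀ = F := hFpsd.isHermitian.eq
  have hclosed := Care.convexHull_numericalRange_closedLoop_subset hFsymm hX (hXlead n hn)
    (Set.subset_union_of_subset_left (Set.subset_biUnion_of_mem (u := fun j => Care.numericalRange
      (Care.toComplex (Care.closedLoop (Care.leading A j) (Care.leading F j) (Xlead j)))) hn) _)
    hEhull hE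
  exact theorem2p2_general hFsymm hX.posSemidef.isHermitian.eq hX.riccati hclosed (by lia) h hs
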